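/- There is an algorithm that, given a finite connected graph $X$, decides in time polynomial in the number of vertices of $X$ whether there exist trees $T_1$ and $T_2$ and a function $f\colon V(T_1)\to V(T_2)$ such that $X\cong T_1\otimes_f T_2$; and there is likewise a polynomial-time algorithm that decides whether such $T_1,T_2,f$ exist with both $T_1$ and $T_2$ having at least two vertices. Here, for graphs $G,H$ and $f\colon V(G)\to V(H)$, the Sierpiński product $G\otimes_f H$ is the graph with vertex set $V(G)\times V(H)$ whose edges are $(g,h)(g,h')$ for all $g\in V(G)$ and $hh'\in E(H)$, and $(g,f(g'))(g',f(g))$ for all $gg'\in E(G)$. The graph $X$ is given by its number of vertices and its adjacency matrix, and running time is the number of steps of a random access machine whose arithmetic operations are addition and truncated subtraction of natural numbers, each at unit cost (this is polynomially equivalent to Turing machine time). -/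

import Mathlib

/-- The Sierpiński product `G ⊗_f H`: the vertex set is `V(G) × V(H)`; `(g, h)(g, h')` is an edge
whenever `hh'` is an edge of `H`, and `(g, f g')(g', f g)` is an edge whenever `gg'` is an edge
of `G`. -/
def sierpinskiProduct {V W : Type*} (G : SimpleGraph V) (H : SimpleGraph W) (f : V → W) :
    SimpleGraph (V × W) where
  Adj p q := (p.1 = q.1 ∧ H.Adj p.2 q.2) ∨ (G.Adj p.1 q.1 ∧ p.2 = f q.1 ∧ q.2 = f p.1)
  symm := ⟨fun _ _ h => h.elim (fun h => Or.inl ⟨h.1.symm, h.2.symm⟩)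
    (fun h => Or.inr ⟨h.1.symm, h.2.2, h.2.1⟩)⟩
  loopless := ⟨fun _ h => h.elim (fun h => H.loopless.irrefl _ h.2)
    (fun h => G.loopless.irrefl _ h.1)⟩

namespace RAM

/-- The state of a random access machine: registers, and random-access arrays, all holding natural
numbers. A program mentions only finitely many registers and arrays, by fixed indices; only cells
inside an array can be addressed indirectly. -/
structure State where
  reg : ℕ → ℕ
  arr : ℕ → ℕ → ℕ

/-- Overwrite register `i` by `v`. -/
def State.setReg (s : State) (i v : ℕ) : State :=
  { s with reg := Function.update s.reg i v }

/-- Overwrite cell `x` of array `a` by `v`. -/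
def State.setCell (s : State) (a x v : ℕ) : State :=
  { s with arr := Function.update s.arr a (Function.update (s.arr a) x v) }

/-- Structured programs of a random access machine. The arithmetic is restricted to addition and
truncated subtraction (no multiplication), so that unit-cost time is polynomially related to the
running time of a Turing machine. -/
inductive Prog where
  /-- do nothing -/
  | skip : Prog
  /-- `R_i := c` -/
  | const (i c : ℕ) : Prog
  /-- `R_i := R_j` -/
  | copy (i j : ℕ) : Prog
  /-- `R_i := R_j + R_k` -/
  | add (i j k : ℕ) : Prog
  /-- `R_i := R_j - R_k`, truncated at `0` -/
  | sub (i j k : ℕ) : Prog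
  /-- `R_i := A_a[R_j]` -/
  | load (i a j : ℕ) : Prog
  /-- `A_a[R_i] := R_j` -/
  | store (a i j : ℕ) : Prog
  /-- run `p`, then `q` -/
  | seq (p q : Prog) : Prog
  /-- if `R_i ≠ 0` then run `p`, else run `q` -/
  | cond (i : ℕ) (p q : Prog) : Prog
  /-- as long as `R_i ≠ 0`, run `p` -/
  | loop (i : ℕ) (p : Prog) : Prog

/-- `Exec p s t s'`: started in state `s`, the program `p` halts after exactly `t` steps, in
state `s'`. Every executed instruction and every evaluated test costs one step. -/
inductive Exec : Prog → State → ℕ → State → Prop where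
  | skip (s : State) : Exec .skip s 1 s
  | const (i c : ℕ) (s : State) : Exec (.const i c) s 1 (s.setReg i c)
  | copy (i j : ℕ) (s : State) : Exec (.copy i j) s 1 (s.setReg i (s.reg j))
  | add (i j k : ℕ) (s : State) : Exec (.add i j k) s 1 (s.setReg i (s.reg j + s.reg k))
  | sub (i j k : ℕ) (s : State) : Exec (.sub i j k) s 1 (s.setReg i (s.reg j - s.reg k))
  | load (i a j : ℕ) (s : State) : Exec (.load i a j) s 1 (s.setReg i (s.arr a (s.reg j)))
  | store (a i j : ℕ) (s : State) : Exec (.store a i j) s 1 (s.setCell a (s.reg i) (s.reg j))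
  | seq {p q : Prog} {s s' s'' : State} {t t' : ℕ} (hp : Exec p s t s') (hq : Exec q s' t' s'') :
      Exec (.seq p q) s (t + t') s''
  | cond_true {i : ℕ} {p q : Prog} {s s' : State} {t : ℕ} (hi : s.reg i ≠ 0)
      (hp : Exec p s t s') : Exec (.cond i p q) s (t + 1) s'
  | cond_false {i : ℕ} {p q : Prog} {s s' : State} {t : ℕ} (hi : s.reg i = 0)
      (hq : Exec q s t s') : Exec (.cond i p q) s (t + 1) s'
  | loop_true {i : ℕ} {p : Prog} {s s' s'' : State} {t t' : ℕ} (hi : s.reg i ≠ 0)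
      (hp : Exec p s t s') (hl : Exec (.loop i p) s' t' s'') :
      Exec (.loop i p) s (t + t' + 1) s''
  | loop_false {i : ℕ} {p : Prog} {s : State} (hi : s.reg i = 0) : Exec (.loop i p) s 1 s

open Classical in
/-- The initial state for a graph on `n` vertices: register `0` holds `n`, array `0` holds the
adjacency matrix row by row, everything else is `0`. -/
noncomputable def graphInput {n : ℕ} (X : SimpleGraph (Fin n)) : State where
  reg i := if i = 0 then n else 0
  arr a x := if a = 0 ∧ ∃ i j : Fin n, X.Adj i j ∧ x = i.val * n + j.val then 1 else 0

/-- The graph property `Q` can be decided in polynomial time on the class `C` of finite graphs: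
there are one program and one polynomial such that on every graph of the class, of order `n` say,
the program halts within the value of the polynomial at `n` many steps, and register `0` then
holds `1` if the graph has the property and `0` if it does not. -/
def DecidesInPolyTime (C Q : ∀ n : ℕ, SimpleGraph (Fin n) → Prop) : Prop :=
  ∃ (p : Prog) (P : Polynomial ℕ), ∀ (n : ℕ) (X : SimpleGraph (Fin n)), C n X →
    ∃ (t : ℕ) (s : State), Exec p (graphInput X) t s ∧ t ≤ P.eval n ∧
      (Q n X → s.reg 0 = 1) ∧ (¬ Q n X → s.reg 0 = 0)

end RAM

/-! A Sierpiński product of two trees is again a tree: it is connected here by assumption, and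
counting edges settles the rest. Every tree `X` is such a product with a one-vertex first factor, so
the first question only asks whether `X` is a tree, which for a connected graph is an edge count.

For nontrivial factors the point is that the size `b` of the second factor determines the fibres. An
edge inside a fibre splits off whole fibres together with a proper nonempty part of one fibre, so
`b` divides neither side; an edge between fibres splits off whole fibres only. Hence the fibres are
the components of `cutForest X b`, and all `b` with `1 < b < n` can be tried.

It remains to test whether the components can be identified with one tree so that all edges into a
given component start at the same vertex of that tree. Colour refinement on the forest is enough for
this: vertices with the same stable colour have isomorphic components (`IsEquitable.exists_map`),
and since the quotient by the components is a tree, the isomorphisms can be chosen leaf by leaf to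
be compatible (`IsTree.exists_choice`). This gives `IsTree.exists_sierpinskiProduct`; the converse
is `IsTree.isUniformlyCut_of_iso`.

For the running time, the criterion is written as terms with bounded sums over 0/1 tables that are
filled by dynamic programming. Such terms compile to programs with polynomial bounds
(`Term.code_spec`, `decidesInPolyTime_of_terms`). -/

namespace RAM

/-! ### Time-bounded specifications of programs -/

@[simp] theorem State.setReg_reg (s : State) (i v j : ℕ) :
    (s.setReg i v).reg j = if j = i then v else s.reg j := by
  simp [State.setReg, Function.update_apply]

@[simp] theorem State.setReg_arr (s : State) (i v : ℕ) : (s.setReg i v).arr = s.arr := rfl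

@[simp] theorem State.setCell_reg (s : State) (a x v : ℕ) : (s.setCell a x v).reg = s.reg := rfl

/-- Started in `s`, the program `p` halts within `B` steps in a state satisfying `Q`. -/
def Runs (p : Prog) (s : State) (B : ℕ) (Q : State → Prop) : Prop :=
  ∃ t s', Exec p s t s' ∧ t ≤ B ∧ Q s'

theorem Runs.weaken {p : Prog} {s : State} {B B' : ℕ} {Q Q' : State → Prop}
    (h : Runs p s B Q) (hB : B ≤ B') (hQ : ∀ s', Q s' → Q' s') : Runs p s B' Q' := by
  obtain ⟨t, s', h1, h2, h3⟩ := h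
  exact ⟨t, s', h1, h2.trans hB, hQ _ h3⟩

theorem Runs.seq {p q : Prog} {s : State} {B B' : ℕ} {Q Q' : State → Prop}
    (h : Runs p s B Q) (h' : ∀ s', Q s' → Runs q s' B' Q') : Runs (.seq p q) s (B + B') Q' := by
  obtain ⟨t, s', h1, h2, h3⟩ := h
  obtain ⟨t', s'', h1', h2', h3'⟩ := h' s' h3
  exact ⟨_, _, .seq h1 h1', add_le_add h2 h2', h3'⟩

theorem Runs.const {i c : ℕ} {s : State} {Q : State → Prop} (h : Q (s.setReg i c)) :
    Runs (.const i c) s 1 Q := ⟨_, _, .const i c s, le_rfl, h⟩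

theorem Runs.copy {i j : ℕ} {s : State} {Q : State → Prop} (h : Q (s.setReg i (s.reg j))) :
    Runs (.copy i j) s 1 Q := ⟨_, _, .copy i j s, le_rfl, h⟩

theorem Runs.add {i j k : ℕ} {s : State} {Q : State → Prop}
    (h : Q (s.setReg i (s.reg j + s.reg k))) :
    Runs (.add i j k) s 1 Q := ⟨_, _, .add i j k s, le_rfl, h⟩

theorem Runs.sub {i j k : ℕ} {s : State} {Q : State → Prop}
    (h : Q (s.setReg i (s.reg j - s.reg k))) :
    Runs (.sub i j k) s 1 Q := ⟨_, _, .sub i j k s, le_rfl, h⟩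

theorem Runs.load {i a j : ℕ} {s : State} {Q : State → Prop}
    (h : Q (s.setReg i (s.arr a (s.reg j)))) :
    Runs (.load i a j) s 1 Q := ⟨_, _, .load i a j s, le_rfl, h⟩

theorem Runs.store {a i j : ℕ} {s : State} {Q : State → Prop}
    (h : Q (s.setCell a (s.reg i) (s.reg j))) :
    Runs (.store a i j) s 1 Q := ⟨_, _, .store a i j s, le_rfl, h⟩

/-- A loop whose register `r` counts down from `N`, with an invariant indexed by the number of
completed rounds. -/
theorem Runs.loop {body : Prog} {r N c : ℕ} {I : ℕ → State → Prop}
    (hbody : ∀ k < N, ∀ s, I k s → s.reg r = N - k →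
      Runs body s c (fun s' => I (k + 1) s' ∧ s'.reg r = N - (k + 1)))
    {s : State} (h0 : I 0 s) (hr : s.reg r = N) :
    Runs (.loop r body) s (N * (c + 1) + 1) (I N) := by
  suffices H : ∀ m k, k + m = N → ∀ s, I k s → s.reg r = N - k →
      Runs (.loop r body) s (m * (c + 1) + 1) (I N) from
    H N 0 (by omega) s h0 (by simpa using hr)
  intro m
  induction m with
  | zero =>
    intro k hk s hI hs
    obtain rfl : k = N := by omega
    exact ⟨1, s, .loop_false (by simpa using hs), by simp, hI⟩
  | succ m ih =>
    intro k hk s hI hs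
    obtain ⟨t, s', h1, h2, h3, h4⟩ := hbody k (by omega) s hI hs
    obtain ⟨t', s'', h1', h2', h3'⟩ := ih (k + 1) (by omega) s' h3 h4
    exact ⟨_, _, .loop_true (by omega) h1 h1', by nlinarith, h3'⟩

/-! ### Terms with bounded sums and their compilation -/

/-- Arithmetic terms over variables and tables, with summation as the only binder. -/
inductive Term where
  | var (i : ℕ) : Term
  | const (c : ℕ) : Term
  | add (x y : Term) : Term
  | sub (x y : Term) : Term
  | mul (x y : Term) : Term
  | load (a : ℕ) (x : Term) : Term
  /-- the sum of `x` over all values less than `m` of variable `i` -/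
  | sum (i : ℕ) (m x : Term) : Term

/-- The value of a term for given tables and values of the variables. -/
def Term.ev (A : ℕ → ℕ → ℕ) : Term → (ℕ → ℕ) → ℕ
  | .var i, ρ => ρ i
  | .const c, _ => c
  | .add x y, ρ => x.ev A ρ + y.ev A ρ
  | .sub x y, ρ => x.ev A ρ - y.ev A ρ
  | .mul x y, ρ => x.ev A ρ * y.ev A ρ
  | .load a x, ρ => A a (x.ev A ρ)
  | .sum i m x, ρ => ∑ k ∈ Finset.range (m.ev A ρ), x.ev A (Function.update ρ i k)

/-- A program that evaluates a term into register `2 * t + 1`. Variable `i` lives in register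
`2 * i`; the odd registers from `2 * t + 1` on are scratch space. -/
def Term.code : Term → ℕ → Prog
  | .var i, t => .copy (2 * t + 1) (2 * i)
  | .const c, t => .const (2 * t + 1) c
  | .add x y, t => .seq (x.code t) (.seq (y.code (t + 1)) (.add (2 * t + 1) (2 * t + 1) (2 * t + 3)))
  | .sub x y, t => .seq (x.code t) (.seq (y.code (t + 1)) (.sub (2 * t + 1) (2 * t + 1) (2 * t + 3)))
  | .mul x y, t => .seq (x.code (t + 1)) (.seq (y.code (t + 2)) (.seq (.const (2 * t + 1) 0)
      (.seq (.const (2 * t + 7) 1) (.loop (2 * t + 3)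
        (.seq (.add (2 * t + 1) (2 * t + 1) (2 * t + 5))
          (.sub (2 * t + 3) (2 * t + 3) (2 * t + 7)))))))
  | .load a x, t => .seq (x.code t) (.load (2 * t + 1) a (2 * t + 1))
  | .sum i m x, t => .seq (m.code (t + 1)) (.seq (.copy (2 * t + 5) (2 * i))
      (.seq (.const (2 * t + 1) 0) (.seq (.const (2 * i) 0) (.seq (.loop (2 * t + 3)
        (.seq (x.code (t + 3)) (.seq (.add (2 * t + 1) (2 * t + 1) (2 * t + 7))
          (.seq (.const (2 * t + 7) 1) (.seq (.add (2 * i) (2 * i) (2 * t + 7))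
            (.sub (2 * t + 3) (2 * t + 3) (2 * t + 7)))))))
        (.copy (2 * i) (2 * t + 5))))))

open Polynomial in
/-- A bound for the value of a term, in terms of a bound for its variables, over tables with
entries `0` and `1`. -/
noncomputable def Term.valueBound : Term → ℕ[X]
  | .var _ => X
  | .const c => C c
  | .add x y => x.valueBound + y.valueBound
  | .sub x _ => x.valueBound
  | .mul x y => x.valueBound * y.valueBound
  | .load _ _ => 1
  | .sum _ m x => m.valueBound * x.valueBound.comp (X + m.valueBound)

open Polynomial in
/-- A bound for the running time of `Term.code`. -/
noncomputable def Term.timeBound : Term → ℕ[X]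
  | .var _ => 1
  | .const _ => 1
  | .add x y => x.timeBound + (y.timeBound + 1)
  | .sub x y => x.timeBound + (y.timeBound + 1)
  | .mul x y => x.timeBound + (y.timeBound + (1 + (1 + (x.valueBound * (2 + 1) + 1))))
  | .load _ x => x.timeBound + 1
  | .sum _ m x => m.timeBound + (1 + (1 + (1 +
      (m.valueBound * ((x.timeBound.comp (X + m.valueBound) + 4) + 1) + 1 + 1))))

/-- Since table entries are at most `1`, the bound depends on the variables alone and not on what
the tables contain. -/
theorem Term.ev_le (A : ℕ → ℕ → ℕ) (hA : ∀ a x, A a x ≤ 1) (e : Term) :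
    ∀ (ρ : ℕ → ℕ) (m : ℕ), (∀ i, ρ i ≤ m) → e.ev A ρ ≤ e.valueBound.eval m := by
  induction e with
  | var i => intro ρ m h; simpa [ev, valueBound] using h i
  | const c => intro ρ m h; simp [ev, valueBound]
  | add x y hx hy =>
    intro ρ m h
    simpa [ev, valueBound] using add_le_add (hx ρ m h) (hy ρ m h)
  | sub x y hx hy =>
    intro ρ m h
    simpa [ev, valueBound] using (hx ρ m h).trans (Nat.le_add_right _ _)
  | mul x y hx hy =>
    intro ρ m h
    simpa [ev, valueBound] using Nat.mul_le_mul (hx ρ m h) (hy ρ m h)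
  | load a x hx => intro ρ m h; simpa [ev, valueBound] using hA _ _
  | sum i M x hM hx =>
    intro ρ m h
    simp only [ev, valueBound, Polynomial.eval_mul, Polynomial.eval_comp, Polynomial.eval_add,
      Polynomial.eval_X]
    -- The summation variable stays below the value of `M`, so `m + M.valueBound.eval m` bounds all
    -- variables inside the sum.
    calc _ ≤ ∑ k ∈ Finset.range (M.ev A ρ), x.valueBound.eval (m + M.valueBound.eval m) := by
            refine Finset.sum_le_sum fun k hk => hx _ _ fun j => ?_
            have := hM ρ m h
            have hk := Finset.mem_range.1 hk
            have := h j
            rw [Function.update_apply]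
            split_ifs <;> omega
      _ ≤ _ := by
            simpa using Nat.mul_le_mul_right _ (hM ρ m h)

/-- The values of the variables in a state. -/
def State.env (s : State) : ℕ → ℕ := fun i => s.reg (2 * i)

theorem State.env_apply (s : State) (i : ℕ) : s.env i = s.reg (2 * i) := rfl

theorem State.env_eq {s s' : State} (h : ∀ r, r % 2 = 0 → s'.reg r = s.reg r) :
    s'.env = s.env := funext fun i => h _ (by omega)

/-- The frame condition carries the induction: variables sit in even registers, and an operand
stored at level `t` survives the evaluation of another one at a higher level. -/
theorem Term.code_spec (e : Term) : ∀ (t : ℕ) (s : State) (m : ℕ),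
    (∀ a x, s.arr a x ≤ 1) → (∀ i, s.env i ≤ m) →
    Runs (e.code t) s (e.timeBound.eval m) (fun s' => s'.arr = s.arr ∧
      s'.reg (2 * t + 1) = e.ev s.arr s.env ∧
      ∀ r, (r % 2 = 0 ∨ r < 2 * t + 1) → s'.reg r = s.reg r) := by
  induction e with
  | var i =>
    intro t s m hA hm
    simp only [code, timeBound, Polynomial.eval_one]
    refine .copy ⟨rfl, by simp [ev, State.env], fun r hr => ?_⟩
    simp; omega
  | const c =>
    intro t s m hA hm
    simp only [code, timeBound, Polynomial.eval_one]
    refine .const ⟨rfl, by simp [ev], fun r hr => ?_⟩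
    simp; omega
  | add x y hx hy =>
    intro t s m hA hm
    simp only [code, timeBound, Polynomial.eval_add, Polynomial.eval_one]
    refine (hx t s m hA hm).seq ?_
    rintro s1 ⟨h1, h2, h3⟩
    have he : s1.env = s.env := State.env_eq fun r hr => h3 r (.inl hr)
    refine (hy (t + 1) s1 m (h1 ▸ hA) (he ▸ hm)).seq ?_
    rintro s2 ⟨h1', h2', h3'⟩
    refine .add ⟨by simp [h1', h1], ?_, fun r hr => ?_⟩
    · have := h3' (2 * t + 1) (by omega)
      rw [he, h1] at h2'
      simp only [State.setReg_reg, if_true, ev]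
      rw [this, h2, ← h2']
      rfl
    · simp only [State.setReg_reg]
      rw [if_neg (by omega), h3' r (by omega), h3 r hr]
  | sub x y hx hy =>
    intro t s m hA hm
    simp only [code, timeBound, Polynomial.eval_add, Polynomial.eval_one]
    refine (hx t s m hA hm).seq ?_
    rintro s1 ⟨h1, h2, h3⟩
    have he : s1.env = s.env := State.env_eq fun r hr => h3 r (.inl hr)
    refine (hy (t + 1) s1 m (h1 ▸ hA) (he ▸ hm)).seq ?_
    rintro s2 ⟨h1', h2', h3'⟩
    refine .sub ⟨by simp [h1', h1], ?_, fun r hr => ?_⟩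
    · have := h3' (2 * t + 1) (by omega)
      rw [he, h1] at h2'
      simp only [State.setReg_reg, if_true, ev]
      rw [this, h2, ← h2']
      rfl
    · simp only [State.setReg_reg]
      rw [if_neg (by omega), h3' r (by omega), h3 r hr]
  | load a x hx =>
    intro t s m hA hm
    simp only [code, timeBound, Polynomial.eval_add, Polynomial.eval_one]
    refine (hx t s m hA hm).seq ?_
    rintro s1 ⟨h1, h2, h3⟩
    refine .load ⟨by simp [h1], by simp [ev, h1, h2], fun r hr => ?_⟩
    simp only [State.setReg_reg]
    rw [if_neg (by omega), h3 r hr]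
  | mul x y hx hy =>
    intro t s m hA hm
    have hv := x.ev_le s.arr hA s.env m hm
    simp only [code, timeBound, Polynomial.eval_add, Polynomial.eval_one, Polynomial.eval_mul,
      Polynomial.eval_ofNat]
    refine (hx (t + 1) s m hA hm).seq ?_
    rintro s1 ⟨h1, h2, h3⟩
    have he : s1.env = s.env := State.env_eq fun r hr => h3 r (.inl hr)
    refine (hy (t + 2) s1 m (h1 ▸ hA) (he ▸ hm)).seq ?_
    rintro s2 ⟨h1', h2', h3'⟩
    rw [he, h1] at h2'
    refine Runs.seq (Q := fun s3 => s3 = s2.setReg (2 * t + 1) 0) (.const rfl) ?_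
    rintro s3 rfl
    refine Runs.seq (Q := fun s4 => s4 = (s2.setReg (2 * t + 1) 0).setReg (2 * t + 7) 1)
      (.const rfl) ?_
    rintro s4 rfl
    have h2'' := (h3' (2 * (t + 1) + 1) (by omega)).trans h2
    -- Repeated addition: register `2 * t + 3` counts down from the first factor, `2 * t + 5` holds
    -- the second and `2 * t + 7` the constant `1`.
    refine (Runs.loop (c := 2) (N := x.ev s.arr s.env) (I := fun k s' => s'.arr = s.arr ∧
      s'.reg (2 * t + 1) = k * y.ev s.arr s.env ∧ s'.reg (2 * t + 5) = y.ev s.arr s.env ∧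
      s'.reg (2 * t + 7) = 1 ∧
      ∀ r, (r % 2 = 0 ∨ r < 2 * t + 1) → s'.reg r = s.reg r) ?_ ?_ ?_).weaken ?_ ?_
    · rintro k hk u ⟨g1, g2, g3, g4, g5⟩ hr
      refine Runs.seq (B := 1) (B' := 1) (.add (Q := fun u' => u' = _) rfl) ?_
      rintro _ rfl
      refine .sub ⟨⟨g1, ?_, ?_, ?_, fun r hr => ?_⟩, ?_⟩
      · simp [g2, g3]; ring
      · simp [g3]
      · simp [g4]
      · simp only [State.setReg_reg]
        rw [if_neg (by omega), if_neg (by omega), g5 r hr]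
      · simp [hr, g4]; omega
    · refine ⟨by simp [h1, h1'], by simp, ?_, by simp, fun r hr => ?_⟩
      · simp; exact h2'
      · simp only [State.setReg_reg]
        rw [if_neg (by omega), if_neg (by omega), h3' r (by omega), h3 r (by omega)]
    · simp; exact h2''
    · gcongr
    · rintro u ⟨g1, g2, g3, g4, g5⟩
      exact ⟨g1, by simp [g2, ev], g5⟩
  | sum i M x hM hx =>
    intro t s m hA hm
    have hv := M.ev_le s.arr hA s.env m hm
    simp only [code, timeBound, Polynomial.eval_add, Polynomial.eval_one, Polynomial.eval_mul,
      Polynomial.eval_ofNat, Polynomial.eval_comp, Polynomial.eval_X]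
    refine (hM (t + 1) s m hA hm).seq ?_
    rintro s1 ⟨h1, h2, h3⟩
    refine Runs.seq (.copy (Q := fun u' => u' = _) rfl) ?_
    rintro _ rfl
    refine Runs.seq (.const (Q := fun u' => u' = _) rfl) ?_
    rintro _ rfl
    refine Runs.seq (.const (Q := fun u' => u' = _) rfl) ?_
    rintro _ rfl
    -- The summation variable's register `2 * i` is overwritten during the loop, hence excluded from
    -- the frame; its old value waits in `2 * t + 5`. Register `2 * t + 7` serves both for the
    -- summand and for the constant `1`.
    refine Runs.seq ((Runs.loop (c := x.timeBound.eval (m + M.valueBound.eval m) + 4)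
      (N := M.ev s.arr s.env) (I := fun k s' => s'.arr = s.arr ∧
      s'.reg (2 * t + 1) =
        ∑ j ∈ Finset.range k, x.ev s.arr (Function.update s.env i j) ∧
      s'.reg (2 * i) = k ∧ s'.reg (2 * t + 5) = s.reg (2 * i) ∧
      ∀ r, (r % 2 = 0 ∨ r < 2 * t + 1) → r ≠ 2 * i → s'.reg r = s.reg r) ?_ ?_ ?_).weaken
        (Nat.add_le_add_right (Nat.mul_le_mul_right _ hv) 1) (fun _ h => h)) ?_
    · rintro k hk u ⟨g1, g2, g3, g4, g5⟩ hr
      have he : u.env = Function.update s.env i k := by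
        funext j
        rw [Function.update_apply, State.env_apply]
        split_ifs with hj
        · rw [hj, g3]
        · rw [g5 _ (by omega) (by omega)]; rfl
      refine (hx (t + 3) u (m + M.valueBound.eval m) (g1 ▸ hA) ?_).seq (B' := 4) ?_
      · intro j
        rw [he, Function.update_apply]
        have := hm j
        split_ifs <;> omega
      rintro u1 ⟨f1, f2, f3⟩
      refine Runs.seq (B := 1) (B' := 3) (.add (Q := fun u' => u' = _) rfl) ?_
      rintro _ rfl
      refine Runs.seq (B := 1) (B' := 2) (.const (Q := fun u' => u' = _) rfl) ?_
      rintro _ rfl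
      refine Runs.seq (B := 1) (B' := 1) (.add (Q := fun u' => u' = _) rfl) ?_
      rintro _ rfl
      have e1 := f3 (2 * t + 1) (by omega)
      have e2 := f3 (2 * i) (by omega)
      have e3 := f3 (2 * t + 5) (by omega)
      have e4 := f3 (2 * t + 3) (by omega)
      -- Scratch registers are odd and variables even, so they never collide.
      have o1 : ∀ c, 2 * t + (2 * c + 1) ≠ 2 * i := by omega
      have o2 : ∀ c, 2 * i ≠ 2 * t + (2 * c + 1) := by omega
      have f2' : u1.reg (2 * t + 7) = x.ev s.arr (Function.update s.env i k) := by
        rw [← he, ← g1]; exact f2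
      refine .sub ⟨⟨f1.trans g1, ?_, ?_, ?_, fun r hr hri => ?_⟩, ?_⟩
      · simp [o1 0, f2', e1, g2, Finset.sum_range_succ]
      · simp [o2 0, o2 1, o2 3, e2, g3]
      · simp [o1 2, e3, g4]
      · simp only [State.setReg_reg]
        rw [if_neg (by omega), if_neg hri, if_neg (by omega), if_neg (by omega), f3 r (by omega),
          g5 r hr hri]
      · simp [o1 1, o1 3, e4, hr]; omega
    · have o1 : ∀ c, 2 * t + (2 * c + 1) ≠ 2 * i := by omega
      refine ⟨by simp [h1], by simp [o1 0], by simp, ?_, fun r hr hri => ?_⟩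
      · simp [o1 2]
        exact h3 _ (by omega)
      · simp only [State.setReg_reg]
        by_cases h : r = 2 * t + 1
        · omega
        · rw [if_neg hri, if_neg h, if_neg (by omega), h3 r (by omega)]
    · have o1 : ∀ c, 2 * t + (2 * c + 1) ≠ 2 * i := by omega
      simp [o1 1]
      exact h2
    · rintro u ⟨g1, g2, g3, g4, g5⟩
      have o1 : ∀ c, 2 * t + (2 * c + 1) ≠ 2 * i := by omega
      refine .copy ⟨g1, by simp [o1 0, g2, ev], fun r hr => ?_⟩
      simp only [State.setReg_reg]
      split_ifs with h
      · rw [h, g4]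
      · exact g5 r hr h

end RAM

/-! ### Logical connectives as terms, and programs that fill tables -/

namespace RAM

namespace Term

/-- The truth value of a term. -/
def tr (A : ℕ → ℕ → ℕ) (e : Term) (ρ : ℕ → ℕ) : Prop := e.ev A ρ ≠ 0

def not (x : Term) : Term := .sub (.const 1) x

def bool (x : Term) : Term := x.not.not

def and (x y : Term) : Term := .mul x y

def or (x y : Term) : Term := .add x y

def lt (x y : Term) : Term := .sub y x

def eq (x y : Term) : Term := not (.add (.sub x y) (.sub y x))

def ex (i : ℕ) (m x : Term) : Term := .sum i m x

def all (i : ℕ) (m x : Term) : Term := not (.sum i m x.not)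

/-- The number of values less than `m` of variable `i` for which `x` is true. -/
def count (i : ℕ) (m x : Term) : Term := .sum i m x.bool

def dvd (i : ℕ) (x y : Term) : Term := .ex i (.add y (.const 1)) (.eq (.mul x (.var i)) y)

variable {A : ℕ → ℕ → ℕ} {ρ : ℕ → ℕ} {x y m : Term} {i : ℕ}

@[simp] theorem ev_var : (var i).ev A ρ = ρ i := rfl
@[simp] theorem ev_const : (const i).ev A ρ = i := rfl
@[simp] theorem ev_add : (add x y).ev A ρ = x.ev A ρ + y.ev A ρ := rfl
@[simp] theorem ev_mul : (mul x y).ev A ρ = x.ev A ρ * y.ev A ρ := rfl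
@[simp] theorem tr_load : (load i x).tr A ρ ↔ A i (x.ev A ρ) ≠ 0 := Iff.rfl
@[simp] theorem tr_const : (const i).tr A ρ ↔ i ≠ 0 := Iff.rfl
@[simp] theorem tr_var : (var i).tr A ρ ↔ ρ i ≠ 0 := Iff.rfl

@[simp] theorem tr_not : x.not.tr A ρ ↔ ¬ x.tr A ρ := by
  simp only [tr, not, ev]; omega

open Classical in
@[simp] theorem ev_bool : x.bool.ev A ρ = if x.tr A ρ then 1 else 0 := by
  by_cases h : x.ev A ρ = 0 <;> simp [tr, bool, not, ev, h]; omega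

@[simp] theorem tr_and : (x.and y).tr A ρ ↔ x.tr A ρ ∧ y.tr A ρ := by
  simp [tr, and]

@[simp] theorem tr_or : (x.or y).tr A ρ ↔ x.tr A ρ ∨ y.tr A ρ := by
  simp only [tr, or, ev]; omega

@[simp] theorem tr_lt : (x.lt y).tr A ρ ↔ x.ev A ρ < y.ev A ρ := by
  simp only [tr, lt, ev]; omega

@[simp] theorem tr_eq : (x.eq y).tr A ρ ↔ x.ev A ρ = y.ev A ρ := by
  simp only [tr, eq, not, ev]; omega

@[simp] theorem tr_ex : (ex i m x).tr A ρ ↔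
    ∃ k < m.ev A ρ, x.tr A (Function.update ρ i k) := by
  simp [tr, ex, ev]

@[simp] theorem tr_all : (all i m x).tr A ρ ↔
    ∀ k < m.ev A ρ, x.tr A (Function.update ρ i k) := by
  rw [all, ← ex, tr_not, tr_ex]
  simp

theorem ev_count {n : ℕ} (h : m.ev A ρ = n) : (count i m x).ev A ρ =
    {k : Fin n | x.tr A (Function.update ρ i k)}.ncard := by
  classical
  rw [Set.ncard_eq_toFinset_card', Set.toFinset_ofPred, Finset.card_filter]
  simp only [count, ev, ev_bool, h]
  rw [Finset.sum_range]

theorem tr_dvd (hx : ∀ k, x.ev A (Function.update ρ i k) = x.ev A ρ)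
    (hy : ∀ k, y.ev A (Function.update ρ i k) = y.ev A ρ) :
    (dvd i x y).tr A ρ ↔ x.ev A ρ ∣ y.ev A ρ := by
  simp only [dvd, tr_ex, tr_eq, ev_add, ev_const, ev_mul, ev_var, Function.update_self, hx, hy]
  refine ⟨fun ⟨k, _, hk⟩ => ⟨k, hk.symm⟩, fun ⟨k, hk⟩ => ?_⟩
  -- The search runs over quotients up to the dividend: a positive divisor leaves no larger one, and
  -- for divisor `0` the quotient can be taken to be `0`.
  rcases Nat.eq_zero_or_pos (x.ev A ρ) with h0 | h0
  · exact ⟨0, by omega, by rw [hk, h0]; simp⟩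
  · exact ⟨k, by nlinarith, hk.symm⟩

end Term

/-- The tables after the first `k` cells of table `a` have been filled according to `E`, where
variable `1` is the number of the cell. -/
noncomputable def fillTable (a : ℕ) (E : Term) (ρ : ℕ → ℕ) (A : ℕ → ℕ → ℕ) : ℕ → ℕ → ℕ → ℕ
  | 0 => A
  | k + 1 => Function.update (fillTable a E ρ A k) a (Function.update (fillTable a E ρ A k a) k
      (E.bool.ev (fillTable a E ρ A k) (Function.update ρ 1 k)))

/-- A program that fills the first `m` cells of table `a` according to `E`. -/
def fillCode (a : ℕ) (m E : Term) : Prog :=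
  .seq (m.code 0) (.seq (.const 2 0) (.seq (.loop 1 (.seq (E.bool.code 1) (.seq (.store a 2 3)
    (.seq (.const 3 1) (.seq (.add 2 2 3) (.sub 1 1 3)))))) (.const 2 0)))

open Polynomial in
noncomputable def fillBound (m E : Term) : ℕ[X] :=
  m.timeBound + (1 + (m.valueBound * ((E.bool.timeBound.comp (X + m.valueBound) + 4) + 1) + 1 + 1))

/-- Entries are written through `bool`, so the tables stay within `{0, 1}`, as the value and time
bounds require. -/
theorem fillTable_le (a : ℕ) (E : Term) (ρ : ℕ → ℕ) (A : ℕ → ℕ → ℕ) (hA : ∀ c x, A c x ≤ 1)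
    (k c x : ℕ) : fillTable a E ρ A k c x ≤ 1 := by
  induction k generalizing c x with
  | zero => exact hA c x
  | succ k ih =>
    simp only [fillTable, Function.update_apply, Term.ev_bool]
    by_cases h1 : c = a
    · rw [if_pos h1, Function.update_apply]
      by_cases h2 : x = k
      · rw [if_pos h2]
        split_ifs <;> simp
      · rw [if_neg h2]
        exact ih a x
    · rw [if_neg h1]
      exact ih c x

/-- Variable `1` runs through the cells and is reset to `0`, which by `h1` restores the environment.
The entry is evaluated at level `1`, so the loop counter in register `1` survives. -/
theorem fillCode_spec (a : ℕ) (m E : Term) (s : State) (M : ℕ) (hA : ∀ c x, s.arr c x ≤ 1)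
    (hM : ∀ i, s.env i ≤ M) (h1 : s.env 1 = 0) :
    Runs (fillCode a m E) s ((fillBound m E).eval M) (fun s' =>
      s'.arr = fillTable a E s.env s.arr (m.ev s.arr s.env) ∧ s'.env = s.env) := by
  have hv := m.ev_le s.arr hA s.env M hM
  simp only [fillCode, fillBound, Polynomial.eval_add, Polynomial.eval_one, Polynomial.eval_mul,
      Polynomial.eval_ofNat, Polynomial.eval_comp, Polynomial.eval_X]
  refine (m.code_spec 0 s M hA hM).seq ?_
  rintro s1 ⟨g1, g2, g3⟩
  refine Runs.seq (.const (Q := fun u' => u' = _) rfl) ?_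
  rintro _ rfl
  refine Runs.seq ((Runs.loop (c := E.bool.timeBound.eval (M + m.valueBound.eval M) + 4)
    (N := m.ev s.arr s.env) (I := fun k s' => s'.arr = fillTable a E s.env s.arr k ∧
      s'.env = Function.update s.env 1 k) ?_ ?_ ?_).weaken
        (Nat.add_le_add_right (Nat.mul_le_mul_right _ hv) 1) (fun _ h => h)) ?_
  · rintro k hk u ⟨f1, f2⟩ hr
    refine (E.bool.code_spec 1 u (M + m.valueBound.eval M) ?_ ?_).seq (B' := 4) ?_
    · rw [f1]; exact fillTable_le _ _ _ _ hA _
    · intro j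
      rw [f2, Function.update_apply]
      have := hM j
      split_ifs <;> omega
    rintro u1 ⟨e1, e2, e3⟩
    refine Runs.seq (B := 1) (B' := 3) (.store (Q := fun u' => u' = _) rfl) ?_
    rintro _ rfl
    refine Runs.seq (B := 1) (B' := 2) (.const (Q := fun u' => u' = _) rfl) ?_
    rintro _ rfl
    refine Runs.seq (B := 1) (B' := 1) (.add (Q := fun u' => u' = _) rfl) ?_
    rintro _ rfl
    have e4 := e3 1 (by omega)
    have e5 : u1.reg 2 = k := by
      rw [e3 2 (by omega), ← State.env_apply u 1, f2]; simp
    have e2' : u1.reg 3 = _ := e2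
    refine .sub ⟨⟨?_, ?_⟩, ?_⟩
    · simp only [State.setReg_arr, State.setCell, fillTable, e5, e1, f1]
      rw [e2', f1, f2]
    · funext j
      rw [State.env_apply, Function.update_apply]
      simp only [State.setReg_reg, State.setCell_reg]
      rw [if_neg (by omega)]
      split_ifs <;> try omega
      rw [e3 _ (by omega), ← State.env_apply, f2, Function.update_of_ne (by omega)]
    · simp [e4, hr]; omega
  · refine ⟨g1, ?_⟩
    funext j
    rw [State.env_apply, Function.update_apply]
    simp only [State.setReg_reg]
    split_ifs <;> try omega
    rw [g3 _ (by omega), State.env_apply]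
  · simpa using g2
  · rintro u ⟨f1, f2⟩
    refine .const ⟨f1, ?_⟩
    funext j
    rw [State.env_apply]
    simp only [State.setReg_reg]
    split_ifs with h
    · obtain rfl : j = 1 := by omega
      exact h1.symm
    · rw [← State.env_apply, f2, Function.update_of_ne (by omega)]

theorem fillTable_of_ne {a c : ℕ} (E : Term) (ρ : ℕ → ℕ) (A : ℕ → ℕ → ℕ) (k : ℕ) (h : c ≠ a) :
    fillTable a E ρ A k c = A c := by
  induction k with
  | zero => rfl
  | succ k ih => simp [fillTable, h, ih]

open Classical in
-- Later rounds write other cells. A cell is computed while exactly the earlier ones are filled,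
-- which is what permits recursive definitions of tables.
theorem fillTable_of_lt (a : ℕ) (E : Term) (ρ : ℕ → ℕ) (A : ℕ → ℕ → ℕ) {k x : ℕ} (h : x < k) :
    fillTable a E ρ A k a x =
      if E.tr (fillTable a E ρ A x) (Function.update ρ 1 x) then 1 else 0 := by
  induction k with
  | zero => omega
  | succ k ih =>
    simp only [fillTable, Function.update_self, Function.update_apply, Term.ev_bool]
    by_cases h1 : x = k
    · rw [if_pos h1, h1]
    · rw [if_neg h1, ih (by omega)]

/-- The tables after all fillings of a list have been made. -/
noncomputable def fillTables (ρ : ℕ → ℕ) (A : ℕ → ℕ → ℕ) : List (ℕ × Term × Term) → ℕ → ℕ → ℕ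
  | [] => A
  | (a, m, E) :: l => fillTables ρ (fillTable a E ρ A (m.ev A ρ)) l

def fillsCode : List (ℕ × Term × Term) → Prog
  | [] => .skip
  | (a, m, E) :: l => .seq (fillCode a m E) (fillsCode l)

noncomputable def fillsBound : List (ℕ × Term × Term) → Polynomial ℕ
  | [] => 1
  | (_, m, E) :: l => fillBound m E + fillsBound l

theorem fillsCode_spec (l : List (ℕ × Term × Term)) (s : State) (M : ℕ)
    (hA : ∀ c x, s.arr c x ≤ 1) (hM : ∀ i, s.env i ≤ M) (h1 : s.env 1 = 0) :
    Runs (fillsCode l) s ((fillsBound l).eval M) (fun s' =>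
      s'.arr = fillTables s.env s.arr l ∧ s'.env = s.env ∧ ∀ c x, s'.arr c x ≤ 1) := by
  induction l generalizing s with
  | nil => exact ⟨1, s, .skip s, by simp [fillsBound], rfl, rfl, hA⟩
  | cons f l ih =>
    obtain ⟨a, m, E⟩ := f
    simp only [fillsCode, fillsBound, Polynomial.eval_add]
    refine (fillCode_spec a m E s M hA hM h1).seq ?_
    rintro s1 ⟨g1, g2⟩
    refine (ih s1 ?_ (g2 ▸ hM) (g2 ▸ h1)).weaken le_rfl ?_
    · rw [g1]; exact fillTable_le _ _ _ _ hA _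
    · rw [g1, g2]; exact fun _ h => h

/-- The values of the variables at the start: variable `0` holds the order of the graph. -/
def inputEnv (n : ℕ) : ℕ → ℕ := fun i => if i = 0 then n else 0

theorem graphInput_env {n : ℕ} (X : SimpleGraph (Fin n)) : (graphInput X).env = inputEnv n := by
  funext i
  simp [State.env, graphInput, inputEnv]

/-- This removes the machine from the problem: from here on it suffices to express the property by
terms. -/
theorem decidesInPolyTime_of_terms {C Q : ∀ n : ℕ, SimpleGraph (Fin n) → Prop}
    (l : List (ℕ × Term × Term)) (e : Term)
    (h : ∀ n X, C n X →
      (e.tr (fillTables (inputEnv n) (graphInput X).arr l) (inputEnv n) ↔ Q n X)) :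
    DecidesInPolyTime C Q := by
  refine ⟨.seq (fillsCode l) (.seq (e.bool.code 0) (.copy 0 1)),
    fillsBound l + (e.bool.timeBound + 1), fun n X hC => ?_⟩
  have hle : ∀ c x, (graphInput X).arr c x ≤ 1 := by
    intro c x
    simp only [graphInput]
    split_ifs <;> simp
  have hM : ∀ i, (graphInput X).env i ≤ n := by
    intro i
    rw [graphInput_env, inputEnv]
    split_ifs <;> simp
  have : Runs (.seq (fillsCode l) (.seq (e.bool.code 0) (.copy 0 1))) (graphInput X)
      ((fillsBound l + (e.bool.timeBound + 1)).eval n)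
      (fun s => s.reg 0 =
        e.bool.ev (fillTables (inputEnv n) (graphInput X).arr l) (inputEnv n)) := by
    simp only [Polynomial.eval_add, Polynomial.eval_one]
    refine (fillsCode_spec l (graphInput X) n hle hM
      (by simp [graphInput_env, inputEnv])).seq ?_
    rintro s1 ⟨g1, g2, g3⟩
    refine (e.bool.code_spec 0 s1 n g3 (g2 ▸ hM)).seq ?_
    rintro s2 ⟨f1, f2, f3⟩
    refine .copy ?_
    simp only [State.setReg_reg, if_true]
    rw [← graphInput_env X, ← g1, ← g2]
    exact f2
  obtain ⟨t, s, h1, h2, h3⟩ := this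
  refine ⟨t, s, h1, h2, fun hQ => ?_, fun hQ => ?_⟩
  · rw [h3, Term.ev_bool, if_pos ((h n X hC).2 hQ)]
  · rw [h3, Term.ev_bool, if_neg (fun h' => hQ ((h n X hC).1 h'))]

end RAM

/-! ### Tables for relations that evolve in time -/

namespace RAM

/-- The cell in which a table holds the truth value of a binary relation on `0, …, n - 1`, with a
parameter `p` and at time `t ≤ n * n`. -/
def slot (n p t u v : ℕ) : ℕ := ((p * (n * n + 1) + t) * n + u) * n + v

theorem mul_add_inj {m a b c d : ℕ} (hb : b < m) (hd : d < m) (h : a * m + b = c * m + d) :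
    a = c ∧ b = d := by
  have h1 := congrArg (· / m) h
  have h2 := congrArg (· % m) h
  simp only [Nat.add_comm _ b, Nat.add_comm _ d, Nat.add_mul_div_right _ _ (by omega : 0 < m),
    Nat.add_mul_mod_self_right, Nat.div_eq_of_lt hb, Nat.div_eq_of_lt hd, Nat.mod_eq_of_lt hb,
    Nat.mod_eq_of_lt hd] at h1 h2
  omega

theorem mul_add_lt {m k a b : ℕ} (ha : a < k) (hb : b < m) : a * m + b < k * m := by
  have := Nat.mul_le_mul_right m (Nat.succ_le_of_lt ha)
  rw [Nat.succ_mul] at this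
  omega

theorem slot_inj {n p t u v p' t' u' v' : ℕ} (ht : t < n * n + 1) (hu : u < n) (hv : v < n)
    (ht' : t' < n * n + 1) (hu' : u' < n) (hv' : v' < n)
    (h : slot n p t u v = slot n p' t' u' v') : p = p' ∧ t = t' ∧ u = u' ∧ v = v' := by
  obtain ⟨h, hv⟩ := mul_add_inj hv hv' h
  obtain ⟨h, hu⟩ := mul_add_inj hu hu' h
  obtain ⟨h, ht⟩ := mul_add_inj ht ht' h
  exact ⟨h, ht, hu, hv⟩

theorem slot_lt {n P p t u v : ℕ} (hp : p < P) (ht : t < n * n + 1) (hu : u < n) (hv : v < n) :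
    slot n p t u v < P * (n * n + 1) * n * n :=
  mul_add_lt (mul_add_lt (mul_add_lt hp ht) hu) hv

/-- For a fixed parameter, time is the leading digit, so all entries of one time are filled before
those of the next. -/
theorem slot_lt_slot_succ {n p t u v u' v' : ℕ} (hu : u < n) (hv : v < n) :
    slot n p t u v < slot n p (t + 1) u' v' := by
  have h1 : (p * (n * n + 1) + t) * n + u < (p * (n * n + 1) + (t + 1)) * n :=
    mul_add_lt (by omega) hu
  have h2 := mul_add_lt h1 hv
  unfold slot
  nlinarith [Nat.zero_le (u' * n)]

namespace Term

/-- The term for `slot`. -/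
def slot (p t u v : Term) : Term :=
  add (mul (add (mul (add (mul p (add (mul (var 0) (var 0)) (const 1))) t) (var 0)) u) (var 0)) v

theorem ev_slot {A : ℕ → ℕ → ℕ} {ρ : ℕ → ℕ} {p t u v : Term} : (slot p t u v).ev A ρ =
    RAM.slot (ρ 0) (p.ev A ρ) (t.ev A ρ) (u.ev A ρ) (v.ev A ρ) := by
  simp [slot, RAM.slot]

/-- The entry of a table from the preceding time. -/
def prev (a : ℕ) (u v : Term) : Term := .load a (slot (.var 2) (.sub (.var 3) (.const 1)) u v)

/-- The entry of a table at the final time. -/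
def final (a : ℕ) (p u v : Term) : Term := .load a (slot p (.mul (.var 0) (.var 0)) u v)

/-- The number of cells of a table. -/
def tableSize : Term := .mul (.mul (.mul (.mul (.var 0) (.var 0))
  (.add (.mul (.var 0) (.var 0)) (.const 1))) (.var 0)) (.var 0)

/-- The entries of a table, the relation at time `0` being given by `init`, and that at a later
time by `step`; the parameter is variable `2`, time is variable `3`, and the relation is between
the variables `4` and `5`. -/
def table (init step : Term) : Term :=
  ex 2 (.mul (.var 0) (.var 0)) (ex 3 (.add (.mul (.var 0) (.var 0)) (.const 1))
    (ex 4 (.var 0) (ex 5 (.var 0) (and (eq (.var 1) (slot (.var 2) (.var 3) (.var 4) (.var 5)))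
      (or (and (not (.var 3)) init) (and (.var 3) step))))))

end Term

/-- The values of the variables while an entry of a table is being computed. -/
def tableEnv (n i p t u v : ℕ) : ℕ → ℕ :=
  Function.update (Function.update (Function.update (Function.update (Function.update
    (inputEnv n) 1 i) 2 p) 3 t) 4 u) 5 v

/-- Strong induction on the cell number. The hypotheses range over all `B` agreeing with `A` off `a`
because entries are evaluated on a partially filled table. -/
theorem fillTable_table (a : ℕ) (init step : Term) (A : ℕ → ℕ → ℕ) (n : ℕ)
    (R : ℕ → ℕ → Fin n → Fin n → Prop)
    (h0 : ∀ B : ℕ → ℕ → ℕ, (∀ c ≠ a, B c = A c) → ∀ i, ∀ p < n * n, ∀ u v : Fin n,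
      (init.tr B (tableEnv n i p 0 u v) ↔ R p 0 u v))
    (h1 : ∀ B : ℕ → ℕ → ℕ, (∀ c ≠ a, B c = A c) → ∀ i, ∀ p < n * n, ∀ t,
      (∀ u v : Fin n, B a (slot n p t u v) ≠ 0 ↔ R p t u v) → ∀ u v : Fin n,
      (step.tr B (tableEnv n i p (t + 1) u v) ↔ R p (t + 1) u v))
    (B : ℕ → ℕ → ℕ) (hB : B = fillTable a (.table init step) (inputEnv n) A
      (Term.tableSize.ev A (inputEnv n))) :
    (∀ c ≠ a, B c = A c) ∧ ∀ p < n * n, ∀ t ≤ n * n, ∀ u v : Fin n,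
      B a (slot n p t u v) ≠ 0 ↔ R p t u v := by
  have hsize : Term.tableSize.ev A (inputEnv n) = n * n * (n * n + 1) * n * n := by
    simp [Term.tableSize, inputEnv]
  rw [hsize] at hB
  have key : ∀ k, ∀ p < n * n, ∀ t ≤ n * n, ∀ u v : Fin n, slot n p t u v < k →
      (fillTable a (.table init step) (inputEnv n) A k a (slot n p t u v) ≠ 0 ↔ R p t u v) := by
    intro k
    induction k using Nat.strong_induction_on with
    | _ k ih =>
    intro p hp t ht u v hk
    rw [fillTable_of_lt _ _ _ _ hk]
    have hne : ∀ c ≠ a, fillTable a (.table init step) (inputEnv n) A (slot n p t u v) c = A c :=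
      fun c hc => fillTable_of_ne _ _ _ _ hc
    have h2 : ∀ (q : Prop) [Decidable q], (if q then 1 else 0) ≠ 0 ↔ q := by
      intro q _; by_cases q <;> simp [*]
    rw [h2]
    -- The cell number is decoded by exhaustive search instead of division; `slot_inj` makes the
    -- quadruple found unique.
    have h3 : (Term.table init step).tr
        (fillTable a (.table init step) (inputEnv n) A (slot n p t u v))
        (Function.update (inputEnv n) 1 (slot n p t u v)) ↔ 
        ((t = 0 ∧ init.tr (fillTable a (.table init step) (inputEnv n) A (slot n p t u v))
          (tableEnv n (slot n p t u v) p t u v)) ∨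
        (t ≠ 0 ∧ step.tr (fillTable a (.table init step) (inputEnv n) A (slot n p t u v))
          (tableEnv n (slot n p t u v) p t u v))) := by
      generalize fillTable a (.table init step) (inputEnv n) A (slot n p t u v) = D
      simp only [Term.table, Term.tr_ex, Term.tr_and, Term.tr_or, Term.tr_not, Term.tr_var,
        Term.tr_eq, Term.ev_mul, Term.ev_add, Term.ev_var, Term.ev_const, Term.ev_slot]
      constructor
      · rintro ⟨p', hp', t', ht', u', hu', v', hv', h, h'⟩
        simp [inputEnv] at hp' ht' hu' hv' h
        obtain ⟨rfl, rfl, rfl, rfl⟩ := slot_inj (by omega) u.2 v.2 (by omega) hu' hv' h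
        simpa [tableEnv] using h'
      · intro h'
        refine ⟨p, by simpa [inputEnv] using hp, t, by simp [inputEnv]; omega, u,
          by simp [inputEnv], v, by simp [inputEnv], by simp [inputEnv], ?_⟩
        simpa [tableEnv] using h'
    rw [h3]
    rcases t with _ | t
    · simpa using h0 _ hne _ p hp u v
    · simpa using h1 _ hne _ p hp t
        (fun u' v' => ih _ hk p hp t (by omega) u' v' (slot_lt_slot_succ u'.2 v'.2)) u v
  subst hB
  exact ⟨fun c hc => fillTable_of_ne _ _ _ _ hc, fun p hp t ht u v =>
    key _ p hp t ht u v (slot_lt hp (by omega) u.2 v.2)⟩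

theorem graphInput_arr_zero {n : ℕ} (X : SimpleGraph (Fin n)) (u v : Fin n) :
    (graphInput X).arr 0 (u * n + v) ≠ 0 ↔ X.Adj u v := by
  simp only [graphInput]
  constructor
  · intro h
    by_contra h'
    refine h (if_neg ?_)
    rintro ⟨-, i, j, hij, h⟩
    obtain ⟨h1, h2⟩ := mul_add_inj v.2 j.2 h
    exact h' (by rwa [Fin.ext h1, Fin.ext h2])
  · intro h
    rw [if_pos ⟨rfl, u, v, h, rfl⟩]
    simp

theorem exists_lt_iff_fin {n : ℕ} (p : ℕ → Prop) : (∃ k < n, p k) ↔ ∃ k : Fin n, p k :=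
  ⟨fun ⟨k, hk, h⟩ => ⟨⟨k, hk⟩, h⟩, fun ⟨k, h⟩ => ⟨k, k.2, h⟩⟩

theorem forall_lt_iff_fin {n : ℕ} (p : ℕ → Prop) : (∀ k < n, p k) ↔ ∀ k : Fin n, p k :=
  ⟨fun h k => h k k.2, fun h k hk => h ⟨k, hk⟩⟩

end RAM

/-! ### Maps between components of forests -/

namespace SimpleGraph

theorem Reachable.transport {V W : Type*} {G : SimpleGraph V} {H : SimpleGraph W} {f : V → W}
    (hf : ∀ a b, G.Adj a b → H.Reachable (f a) (f b)) {u v : V} (h : G.Reachable u v) :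
    H.Reachable (f u) (f v) := by
  obtain ⟨p⟩ := h
  induction p with
  | nil => exact .rfl
  | cons hadj _ ih => exact (hf _ _ hadj).trans ih

theorem Reachable.mem_of_closed {V : Type*} {G : SimpleGraph V} {S : Set V}
    (hS : ∀ a b, G.Adj a b → a ∈ S → b ∈ S) {u v : V} (h : G.Reachable u v) (hu : u ∈ S) :
    v ∈ S := by
  obtain ⟨p⟩ := h
  induction p with
  | nil => exact hu
  | cons hadj _ ih => exact ih (hS _ _ hadj hu)

theorem deleteEdges_pair_adj {V : Type*} {G : SimpleGraph V} {x y u v : V} :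
    (G.deleteEdges {s(x, y)}).Adj u v ↔
      G.Adj u v ∧ ¬ ((u = x ∧ v = y) ∨ (u = y ∧ v = x)) := by
  simp [deleteEdges_adj]

/-- The graph with the edges of `G` that have both ends in `S`. -/
def within {V : Type*} (G : SimpleGraph V) (S : Set V) : SimpleGraph V where
  Adj a b := G.Adj a b ∧ a ∈ S ∧ b ∈ S
  symm := ⟨fun _ _ h => ⟨h.1.symm, h.2.2, h.2.1⟩⟩
  loopless := ⟨fun _ h => G.loopless.irrefl _ h.1⟩

theorem within_mono {V : Type*} {G : SimpleGraph V} {S S' : Set V} (h : S ⊆ S') :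
    G.within S ≤ G.within S' := fun _ _ h' => ⟨h'.1, h h'.2.1, h h'.2.2⟩

theorem Reachable.within {V : Type*} {G : SimpleGraph V} {u v : V} (h : G.Reachable u v) :
    (G.within {w | G.Reachable u w}).Reachable u v := by
  have := h.mem_of_closed (S := {w | G.Reachable u w ∧
    (G.within {w | G.Reachable u w}).Reachable u w}) ?_ ⟨.rfl, .rfl⟩
  · exact this.2
  · rintro a b hab ⟨h1, h2⟩
    have h3 := h1.trans hab.reachable
    exact ⟨h3, h2.trans (Adj.reachable ⟨hab, h1, h3⟩)⟩

theorem IsAcyclic.not_reachable_deleteEdges {V : Type*} {G : SimpleGraph V} (hG : G.IsAcyclic)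
    {x y : V} (h : G.Adj x y) : ¬ (G.deleteEdges {s(x, y)}).Reachable x y :=
  isBridge_iff.1 (isAcyclic_iff_forall_adj_isBridge.1 hG h)

/-- Induction along a component of a forest, adding one leaf at a time. -/
theorem IsAcyclic.component_induction {V : Type*} [Finite V] {G : SimpleGraph V}
    (hG : G.IsAcyclic) (r : V) (P : Set V → Prop) (h0 : P {r})
    (hs : ∀ S x y, r ∈ S → (∀ u ∈ S, ∀ v ∈ S, (G.within S).Reachable u v) → x ∈ S → y ∉ S →
      G.Adj x y → (∀ z ∈ S, G.Adj z y → z = x) → P S → P (insert y S)) :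
    P {v | G.Reachable r v} := by
  -- Induction on the number `k` of vertices of the component still missing from `S`.
  suffices H : ∀ k, ∀ S : Set V, S.ncard + k = {v | G.Reachable r v}.ncard →
      S ⊆ {v | G.Reachable r v} → r ∈ S → (∀ u ∈ S, ∀ v ∈ S, (G.within S).Reachable u v) →
      P S → P {v | G.Reachable r v} by
    have hr : ({r} : Set V) ⊆ {v | G.Reachable r v} := by simp
    have := Set.ncard_le_ncard hr
    refine H ({v | G.Reachable r v}.ncard - ({r} : Set V).ncard) {r} (by omega) hr rfl ?_ h0
    rintro u rfl v rfl
    exact .rfl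
  intro k
  induction k with
  | zero =>
    intro S hc hS _ _ hP
    rwa [← Set.eq_of_subset_of_ncard_le hS (by omega)]
  | succ k ih =>
    intro S hc hS hr hconn hP
    obtain ⟨w, hw, hwS⟩ : ∃ w ∈ {v | G.Reachable r v}, w ∉ S := by
      by_contra! h
      have := Set.ncard_le_ncard (show {v | G.Reachable r v} ⊆ S from h)
      omega
    obtain ⟨p⟩ : G.Reachable r w := hw
    obtain ⟨⟨⟨x, y⟩, hxy⟩, -, hx, hy⟩ := p.exists_boundary_dart S hr hwS
    change x ∈ S at hx
    change y ∉ S at hy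
    change G.Adj x y at hxy
    have hle := within_mono (G := G) (Set.subset_insert y S)
    have hy' : ∀ u ∈ S, (G.within (insert y S)).Reachable u y := fun u hu =>
      ((hconn u hu x hx).mono hle).trans (Adj.reachable ⟨hxy, by simp [hx], by simp⟩)
    refine ih (insert y S) (by rw [Set.ncard_insert_of_notMem hy]; omega)
      (Set.insert_subset ((hS hx).trans hxy.reachable) hS) (by simp [hr]) ?_
      (hs S x y hr hconn hx hy hxy ?_ hP)
    · rintro u (rfl | hu) v (rfl | hv)
      · exact .rfl
      · exact (hy' v hv).symm
      · exact hy' u hu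
      · exact (hconn u hu v hv).mono hle
    · intro z hz hzy
      by_contra hzx
      -- A second neighbour `z` of `y` in `S` would give a way from `x` through `S` to `z` and on to
      -- `y` that avoids the bridge `xy`.
      refine hG.not_reachable_deleteEdges hxy (((hconn x hx z hz).mono ?_).trans
        (Adj.reachable ?_))
      · rintro a b ⟨hab, ha, hb⟩
        rw [deleteEdges_pair_adj]
        refine ⟨hab, ?_⟩
        rintro (⟨rfl, rfl⟩ | ⟨rfl, rfl⟩) <;> contradiction
      · rw [deleteEdges_pair_adj]
        refine ⟨hzy, ?_⟩
        rintro (⟨rfl, _⟩ | ⟨rfl, rfl⟩) <;> contradiction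

/-- An injective homomorphism from a connected graph to a forest reflects adjacency. -/
theorem IsAcyclic.adj_of_adj_map {V W : Type*} {G : SimpleGraph V} {H : SimpleGraph W}
    (hH : H.IsAcyclic) {φ : V → W} {S : Set V} (hinj : S.InjOn φ)
    (hφ : ∀ v ∈ S, ∀ w ∈ S, G.Adj v w → H.Adj (φ v) (φ w)) {x z : V} (hx : x ∈ S) (hz : z ∈ S)
    (h : (G.within S).Reachable x z) (hadj : H.Adj (φ x) (φ z)) : G.Adj x z := by
  by_contra hn
  -- If `xz` is not an edge, then by injectivity the image of a walk from `x` to `z` avoids the edge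
  -- between `φ x` and `φ z`, which is a bridge.
  refine hH.not_reachable_deleteEdges hadj (h.transport (f := φ) ?_)
  rintro a b ⟨hab, ha, hb⟩
  refine Adj.reachable ?_
  rw [deleteEdges_pair_adj]
  refine ⟨hφ a ha b hb hab, ?_⟩
  rintro (⟨h1, h2⟩ | ⟨h1, h2⟩)
  · rw [hinj ha hx h1, hinj hb hz h2] at hab
    exact hn hab
  · rw [hinj ha hz h1, hinj hb hx h2] at hab
    exact hn hab.symm

/-- An equivalence relation on the vertices of `G` such that related vertices have the same number
of neighbours in every class. -/
structure IsEquitable {V : Type*} (G : SimpleGraph V) (R : V → V → Prop) : Prop where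
  equiv : Equivalence R
  card_eq : ∀ u v, R u v → ∀ w,
    {z | G.Adj u z ∧ R z w}.ncard = {z | G.Adj v z ∧ R z w}.ncard

/-- In a forest, vertices related by an equitable relation have isomorphic components. -/
theorem IsEquitable.exists_map {V : Type*} [Finite V] {G : SimpleGraph V} (hG : G.IsAcyclic)
    {R : V → V → Prop} (hR : G.IsEquitable R) {u u' : V} (hu : R u u') :
    ∃ φ : V → V, φ u = u' ∧ {v | G.Reachable u v}.InjOn φ ∧
      (∀ v ∈ {v | G.Reachable u v}, R v (φ v)) ∧
      (∀ v ∈ {v | G.Reachable u v}, G.Reachable u' (φ v)) ∧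
      ∀ v ∈ {v | G.Reachable u v}, ∀ w ∈ {v | G.Reachable u v},
        G.Adj v w → G.Adj (φ v) (φ w) := by
  classical
  refine hG.component_induction u (fun S => ∃ φ : V → V, φ u = u' ∧ S.InjOn φ ∧
    (∀ v ∈ S, R v (φ v)) ∧ (∀ v ∈ S, G.Reachable u' (φ v)) ∧
    ∀ v ∈ S, ∀ w ∈ S, G.Adj v w → G.Adj (φ v) (φ w)) ?_ ?_
  · refine ⟨fun _ => u', rfl, by simp, by simpa using hu, by simp, ?_⟩
    rintro v rfl w rfl h
    exact (G.loopless.irrefl _ h).elim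
  · rintro S x y huS hconn hx hy hxy huniq ⟨φ, h1, h2, h3, h4, h5⟩
    obtain ⟨y', hxy', hyy', hy'⟩ : ∃ y', G.Adj (φ x) y' ∧ R y' y ∧ y' ∉ φ '' S := by
      -- If every neighbour of `φ x` in the class of `y` were used already, it would come from a
      -- neighbour of `x` in that class lying in `S`, because adjacency is reflected. As `y` is not
      -- in `S`, these are too few for equitability.
      by_contra! hcon
      have hlt : {z | (G.Adj x z ∧ R z y) ∧ z ∈ S}.ncard < {z | G.Adj x z ∧ R z y}.ncard :=
        Set.ncard_lt_ncard ⟨fun z hz => hz.1,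
          fun h => hy (h (show y ∈ {z | G.Adj x z ∧ R z y} from ⟨hxy, hR.equiv.refl y⟩)).2⟩
      have hle : {z | G.Adj (φ x) z ∧ R z y} ⊆ φ '' {z | (G.Adj x z ∧ R z y) ∧ z ∈ S} := by
        rintro z' ⟨hz1, hz2⟩
        obtain ⟨z, hz, rfl⟩ := hcon z' hz1 hz2
        exact ⟨z, ⟨⟨hG.adj_of_adj_map h2 h5 hx hz (hconn x hx z hz) hz1,
          hR.equiv.trans (h3 z hz) hz2⟩, hz⟩, rfl⟩
      have := Set.ncard_le_ncard hle
      have := Set.ncard_image_le (f := φ) (s := {z | (G.Adj x z ∧ R z y) ∧ z ∈ S})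
      have := hR.card_eq _ _ (h3 x hx) y
      omega
    have hval : ∀ v ∈ S, Function.update φ y y' v = φ v := fun v hv =>
      Function.update_of_ne (by rintro rfl; exact hy hv) _ _
    refine ⟨Function.update φ y y', by rw [hval u huS, h1], ?_, ?_, ?_, ?_⟩
    · rintro v (rfl | hv) w (rfl | hw) h
      · rfl
      · rw [Function.update_self, hval w hw] at h
        exact (hy' ⟨w, hw, h.symm⟩).elim
      · rw [Function.update_self, hval v hv] at h
        exact (hy' ⟨v, hv, h⟩).elim
      · rw [hval v hv, hval w hw] at h
        exact h2 hv hw h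
    · rintro v (rfl | hv)
      · simpa using hR.equiv.symm hyy'
      · rw [hval v hv]; exact h3 v hv
    · rintro v (rfl | hv)
      · simpa using (h4 x hx).trans hxy'.reachable
      · rw [hval v hv]; exact h4 v hv
    · rintro v (rfl | hv) w (rfl | hw) h
      · exact (G.loopless.irrefl _ h).elim
      · obtain rfl := huniq w hw h.symm
        rw [Function.update_self, hval w hw]
        exact hxy'.symm
      · obtain rfl := huniq v hv h
        rw [Function.update_self, hval v hv]
        exact hxy'
      · rw [hval v hv, hval w hw]
        exact h5 v hv w hw h

/-- Choices at the vertices of a tree can be made so that, for every vertex `c`, they agree on all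
neighbours of `c`, if every two neighbours of a vertex have the same possible values. -/
theorem IsTree.exists_choice {V K L : Type*} [Finite V] {T : SimpleGraph V} (hT : T.IsTree)
    (Φ : V → Set K) (hne : ∀ d, (Φ d).Nonempty) (val : V → V → K → L)
    (hval : ∀ c d d', T.Adj d c → T.Adj d' c → ∀ φ ∈ Φ d, ∃ φ' ∈ Φ d', val d' c φ' = val d c φ) :
    ∃ σ : V → K, (∀ d, σ d ∈ Φ d) ∧
      ∀ c d d', T.Adj d c → T.Adj d' c → val d c (σ d) = val d' c (σ d') := by
  classical
  obtain ⟨r⟩ := hT.connected.nonempty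
  choose σ₀ hσ₀ using hne
  have key := hT.isAcyclic.component_induction r (fun S => ∃ σ : V → K, (∀ d, σ d ∈ Φ d) ∧
    ∀ c ∈ S, ∀ d ∈ S, ∀ d' ∈ S, T.Adj d c → T.Adj d' c → val d c (σ d) = val d' c (σ d')) ?_ ?_
  · have huniv : {v | T.Reachable r v} = Set.univ :=
      Set.eq_univ_of_forall fun v => hT.connected.preconnected r v
    rw [huniv] at key
    simpa using key
  · refine ⟨σ₀, hσ₀, ?_⟩
    rintro c rfl d rfl d' rfl h
    exact (T.loopless.irrefl _ h).elim
  · rintro S x y hr hconn hx hy hxy huniq ⟨σ, h1, h2⟩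
    -- The new leaf `y` is adjacent only to `x` in `S`, so its choice need only agree at `x`, where
    -- the earlier choices already agree with one another.
    obtain ⟨φ, hφ, hφ'⟩ : ∃ φ ∈ Φ y, ∀ d ∈ S, T.Adj d x → val d x (σ d) = val y x φ := by
      by_cases hd : ∃ d ∈ S, T.Adj d x
      · obtain ⟨d, hd, hdx⟩ := hd
        obtain ⟨φ, hφ, h⟩ := hval x d y hdx hxy.symm (σ d) (h1 d)
        exact ⟨φ, hφ, fun d' hd' h' => (h2 x hx d' hd' d hd h' hdx).trans h.symm⟩
      · exact ⟨σ₀ y, hσ₀ y, fun d h h' => (hd ⟨d, h, h'⟩).elim⟩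
    have hupd : ∀ v ∈ S, Function.update σ y φ v = σ v := fun v hv =>
      Function.update_of_ne (by rintro rfl; exact hy hv) _ _
    refine ⟨Function.update σ y φ, fun d => ?_, ?_⟩
    · rw [Function.update_apply]
      split_ifs with h
      · rwa [h]
      · exact h1 d
    · rintro c (rfl | hc) d (rfl | hd) d' (rfl | hd') hdc hdc'
      · rfl
      · exact (T.loopless.irrefl _ hdc).elim
      · exact (T.loopless.irrefl _ hdc').elim
      · rw [huniq d hd hdc, huniq d' hd' hdc']
      · rfl
      · obtain rfl := huniq c hc hdc.symm
        rw [Function.update_self, hupd d' hd']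
        exact (hφ' d' hd' hdc').symm
      · obtain rfl := huniq c hc hdc'.symm
        rw [Function.update_self, hupd d hd]
        exact hφ' d hd hdc
      · rw [hupd d hd, hupd d' hd']
        exact h2 c hc d hd d' hd' hdc hdc'

/-! ### Relations computed in rounds -/

/-- Otherwise the chain would grow strictly `Nat.card α + 1` times. For relations `α = V × V`, which
is why `n * n` rounds suffice throughout. -/
theorem eq_succ_of_card {α : Type*} [Finite α] (f : ℕ → Set α) (hmono : ∀ k, f k ⊆ f (k + 1))
    (hstep : ∀ k, f k = f (k + 1) → f (k + 1) = f (k + 2)) :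
    f (Nat.card α) = f (Nat.card α + 1) := by
  by_contra hne
  have h1 : ∀ j, ∀ k, k + j = Nat.card α → f k ≠ f (k + 1) := by
    intro j
    induction j with
    | zero => rintro k rfl; exact hne
    | succ j ih => exact fun k hk h => ih (k + 1) (by omega) (hstep k h)
  have h2 : ∀ k ≤ Nat.card α + 1, k ≤ (f k).ncard := by
    intro k
    induction k with
    | zero => simp
    | succ k ih =>
      intro hk
      have := Set.ncard_lt_ncard
        ((hmono k).ssubset_of_ne (h1 (Nat.card α - k) k (by omega)))
      have := ih (by omega)
      omega
  have := h2 _ le_rfl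
  have := Set.ncard_le_card (f (Nat.card α + 1))
  omega

variable {V : Type*}

/-- There is a walk of length at most `t`. -/
def ReachableWithin (G : SimpleGraph V) : ℕ → V → V → Prop
  | 0, u, v => u = v
  | t + 1, u, v => G.ReachableWithin t u v ∨ ∃ w, G.ReachableWithin t u w ∧ G.Adj w v

theorem ReachableWithin.reachable {G : SimpleGraph V} {t : ℕ} {u v : V}
    (h : G.ReachableWithin t u v) : G.Reachable u v := by
  induction t generalizing v with
  | zero => rw [show u = v from h]
  | succ t ih =>
    rcases h with h | ⟨w, h, h'⟩
    · exact ih h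
    · exact (ih h).trans h'.reachable

/-- Once the relation is stationary, the set of vertices reached is closed under adjacency. -/
theorem reachableWithin_iff [Finite V] (G : SimpleGraph V) (u v : V) :
    G.ReachableWithin (Nat.card V * Nat.card V) u v ↔ G.Reachable u v := by
  refine ⟨ReachableWithin.reachable, fun h => ?_⟩
  have key := eq_succ_of_card (α := V × V) (fun t => {p | G.ReachableWithin t p.1 p.2})
    (fun t p hp => Or.inl hp) ?_
  · rw [Nat.card_prod] at key
    refine h.mem_of_closed (S := {v | G.ReachableWithin (Nat.card V * Nat.card V) u v}) ?_ ?_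
    · intro a b hab ha
      have : (u, b) ∈ {p : V × V |
          G.ReachableWithin (Nat.card V * Nat.card V + 1) p.1 p.2} := Or.inr ⟨a, ha, hab⟩
      rw [← key] at this
      exact this
    · change G.ReachableWithin _ u u
      generalize Nat.card V * Nat.card V = t
      induction t with
      | zero => rfl
      | succ t ih => exact Or.inl ih
  · intro t ht
    have ht' : ∀ u v, G.ReachableWithin t u v ↔ G.ReachableWithin (t + 1) u v := fun u v =>
      Set.ext_iff.1 ht (u, v)
    ext ⟨u, v⟩
    change (_ ∨ _) ↔ (_ ∨ _)
    simp only [ht']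

/-- The relation after `t` rounds of colour refinement. -/
def Similar (G : SimpleGraph V) : ℕ → V → V → Prop
  | 0, _, _ => True
  | t + 1, u, v => G.Similar t u v ∧ ∀ w,
      {z | G.Adj u z ∧ G.Similar t z w}.ncard = {z | G.Adj v z ∧ G.Similar t z w}.ncard

theorem similar_equivalence (G : SimpleGraph V) (t : ℕ) : Equivalence (G.Similar t) := by
  induction t with
  | zero => exact ⟨fun _ => trivial, fun _ => trivial, fun _ _ => trivial⟩
  | succ t ih => exact ⟨fun u => ⟨ih.refl u, fun _ => rfl⟩,
      fun h => ⟨ih.symm h.1, fun w => (h.2 w).symm⟩,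
      fun h h' => ⟨ih.trans h.1 h'.1, fun w => (h.2 w).trans (h'.2 w)⟩⟩

/-- A relation that one more round leaves unchanged satisfies the counting condition with respect to
itself. Refinement shrinks the relation, so the chain argument is applied to complements. -/
theorem similar_isEquitable [Finite V] (G : SimpleGraph V) :
    G.IsEquitable (G.Similar (Nat.card V * Nat.card V)) := by
  refine ⟨G.similar_equivalence _, fun u v h => ?_⟩
  have key := eq_succ_of_card (α := V × V) (fun t => {p | G.Similar t p.1 p.2}ᶜ)
    (fun t => Set.compl_subset_compl.2 fun p hp => hp.1) ?_
  · rw [Nat.card_prod, compl_inj_iff] at key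
    have h' : (u, v) ∈ {p : V × V | G.Similar (Nat.card V * Nat.card V) p.1 p.2} := h
    rw [key] at h'
    exact h'.2
  · intro t ht
    have ht' : ∀ u v, G.Similar t u v ↔ G.Similar (t + 1) u v := fun u v =>
      Set.ext_iff.1 (compl_inj_iff.1 ht) (u, v)
    refine congrArg _ (Set.ext fun ⟨u, v⟩ => ?_)
    change (_ ∧ _) ↔ (_ ∧ _)
    simp only [ht']

/-- Colour refinement does not separate the vertices related by a bisimulation. -/
theorem similar_of_bisimulation (G : SimpleGraph V) (R : V → V → Prop)
    (hR : ∀ u v, R u v → ∃ e : {z // G.Adj u z} ≃ {z // G.Adj v z}, ∀ z, R z.1 (e z).1) (t : ℕ)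
    {u v : V} (h : R u v) : G.Similar t u v := by
  induction t generalizing u v with
  | zero => trivial
  | succ t ih =>
    refine ⟨ih h, fun w => ?_⟩
    obtain ⟨e, he⟩ := hR u v h
    have hs := G.similar_equivalence t
    -- By induction `e` moves each neighbour within its class of round `t`, so it restricts to a
    -- bijection between the sets counted.
    refine Nat.card_congr
      ⟨fun z => ⟨(e ⟨z.1, z.2.1⟩).1, (e ⟨z.1, z.2.1⟩).2,
        hs.trans (hs.symm (ih (he ⟨z.1, z.2.1⟩))) z.2.2⟩,
      fun z => ⟨(e.symm ⟨z.1, z.2.1⟩).1, (e.symm ⟨z.1, z.2.1⟩).2, ?_⟩, ?_, ?_⟩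
    · have := he (e.symm ⟨z.1, z.2.1⟩)
      rw [e.apply_symm_apply] at this
      exact hs.trans (ih this) z.2.2
    · intro z; simp
    · intro z; simp

end SimpleGraph

/-! ### A product structure from a spanning forest -/

namespace SimpleGraph

/-- A spanning forest of a tree gives a factorization as a Sierpiński product if its components
have the same size and are related by an equitable relation that is compatible with the remaining
edges. -/
theorem IsTree.exists_sierpinskiProduct {V : Type} [Finite V] {X F : SimpleGraph V}
    (hX : X.IsTree) (hF : F ≤ X) {b : ℕ} (hb1 : 1 < b) (hb2 : b < Nat.card V)
    (hsize : ∀ u, {w | F.Reachable u w}.ncard = b) {R : V → V → Prop} (hR : F.IsEquitable R)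
    (hall : ∀ u w, ∃ w', F.Reachable w w' ∧ R u w')
    (hcut : ∀ x y x' y', X.Adj x y → ¬ F.Adj x y → X.Adj x' y' → ¬ F.Adj x' y' →
      F.Reachable y y' → R x x') :
    ∃ (V₁ V₂ : Type) (T₁ : SimpleGraph V₁) (T₂ : SimpleGraph V₂) (f : V₁ → V₂),
      Nontrivial V₁ ∧ Nontrivial V₂ ∧ T₁.IsTree ∧ T₂.IsTree ∧
        Nonempty (X ≃g sierpinskiProduct T₁ T₂ f) := by
  classical
  obtain ⟨r⟩ := hX.connected.nonempty
  have hFac : F.IsAcyclic := hX.isAcyclic.anti hF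
  set q : V → F.ConnectedComponent := F.connectedComponentMk with hq
  have hqq : ∀ {x y}, q x = q y ↔ F.Reachable x y := ConnectedComponent.eq
  have hcutq : ∀ {x y}, X.Adj x y → ¬ F.Adj x y → ¬ F.Reachable x y := by
    intro x y h h' hr
    refine hX.isAcyclic.not_reachable_deleteEdges h (hr.mono fun a c hac => ?_)
    rw [deleteEdges_pair_adj]
    refine ⟨hF hac, ?_⟩
    rintro (⟨rfl, rfl⟩ | ⟨rfl, rfl⟩)
    · exact h' hac
    · exact h' hac.symm
  -- Two edges between the same two components would close a cycle in `X`.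
  have huniq : ∀ {x y x' y'}, X.Adj x y → ¬ F.Adj x y → X.Adj x' y' → ¬ F.Adj x' y' →
      F.Reachable x x' → F.Reachable y y' → x = x' := by
    intro x y x' y' h1 h2 h1' h2' hx hy
    by_contra hne
    have hle : F ≤ X.deleteEdges {s(x, y)} := by
      intro a c hac
      rw [deleteEdges_pair_adj]
      refine ⟨hF hac, ?_⟩
      rintro (⟨rfl, rfl⟩ | ⟨rfl, rfl⟩)
      · exact h2 hac
      · exact h2 hac.symm
    refine hX.isAcyclic.not_reachable_deleteEdges h1 ((hx.mono hle).trans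
      ((Adj.reachable (v := y') ?_).trans (hy.symm.mono hle)))
    rw [deleteEdges_pair_adj]
    refine ⟨h1', ?_⟩
    rintro (⟨rfl, rfl⟩ | ⟨rfl, rfl⟩)
    · exact hne rfl
    · exact hcutq h1 h2 hx
  -- The first factor is the quotient of `X` by the components of `F`; the second will be the
  -- component of `r`.
  let T₁ : SimpleGraph F.ConnectedComponent :=
    { Adj := fun c d => ∃ x y, q x = c ∧ q y = d ∧ X.Adj x y ∧ ¬ F.Adj x y
      symm := ⟨fun _ _ ⟨x, y, h1, h2, h3, h4⟩ => ⟨y, x, h2, h1, h3.symm, fun h => h4 h.symm⟩⟩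
      loopless := ⟨fun _ ⟨_, _, h1, h2, h3, h4⟩ => hcutq h3 h4 (hqq.1 (h1.trans h2.symm))⟩ }
  have hconn : T₁.Connected := by
    refine @Connected.mk _ _ ?_ ⟨q r⟩
    intro c d
    induction c using ConnectedComponent.ind with | _ u
    induction d using ConnectedComponent.ind with | _ v
    refine (hX.connected.preconnected u v).transport (f := q) fun a c hac => ?_
    by_cases h : F.Adj a c
    · rw [hqq.2 h.reachable]
    · exact Adj.reachable ⟨a, c, rfl, rfl, hac, h⟩
  have hacyc : T₁.IsAcyclic := by
    rw [isAcyclic_iff_forall_adj_isBridge]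
    rintro _ _ ⟨x, y, rfl, rfl, hxy, hxy'⟩
    rw [isBridge_iff]
    intro hreach
    have hle : F ≤ X.deleteEdges {s(x, y)} := by
      intro a c hac
      rw [deleteEdges_pair_adj]
      refine ⟨hF hac, ?_⟩
      rintro (⟨rfl, rfl⟩ | ⟨rfl, rfl⟩)
      · exact hxy' hac
      · exact hxy' hac.symm
    -- A path in the quotient avoiding the deleted edge lifts to `X`, since components of `F` stay
    -- connected without `xy`.
    refine hX.isAcyclic.not_reachable_deleteEdges hxy (hreach.mem_of_closed
      (S := {c | ∀ v, q v = c → (X.deleteEdges {s(x, y)}).Reachable x v}) ?_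
      (fun v hv => (hqq.1 hv.symm).mono hle) y rfl)
    rintro c d hcd hc v hv
    rw [deleteEdges_pair_adj] at hcd
    obtain ⟨⟨a, e, ha, he, hae, -⟩, hne⟩ := hcd
    refine (hc a ha).trans ((Adj.reachable (v := e) ?_).trans
      ((hqq.1 (he.trans hv.symm)).mono hle))
    rw [deleteEdges_pair_adj]
    refine ⟨hae, ?_⟩
    rintro (⟨rfl, rfl⟩ | ⟨rfl, rfl⟩)
    · exact hne (.inl ⟨ha.symm, he.symm⟩)
    · exact hne (.inr ⟨ha.symm, he.symm⟩)
  have hT₁ : T₁.IsTree := ⟨hconn, hacyc⟩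
  -- The port is the vertex of `d` at which its edge to `c` starts; `r` is a dummy value for
  -- nonadjacent components.
  have hport : ∀ d c, ∃ x, T₁.Adj d c → q x = d ∧ ∃ y, q y = c ∧ X.Adj x y ∧ ¬ F.Adj x y := by
    intro d c
    by_cases h : T₁.Adj d c
    · obtain ⟨x, y, h1, h2, h3, h4⟩ := h
      exact ⟨x, fun _ => ⟨h1, y, h2, h3, h4⟩⟩
    · exact ⟨r, fun h' => (h h').elim⟩
  choose port hport using hport
  let Φ : F.ConnectedComponent → Set (V → V) := fun d => {φ | {v | q v = d}.InjOn φ ∧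
    (∀ v, q v = d → R v (φ v)) ∧ (∀ v, q v = d → F.Reachable r (φ v)) ∧
    ∀ v w, q v = d → q w = d → F.Adj v w → F.Adj (φ v) (φ w)}
  have hlift : ∀ u w, F.Reachable r w → R u w → ∃ φ ∈ Φ (q u), φ u = w := by
    intro u w hw huw
    obtain ⟨φ, h1, h2, h3, h4, h5⟩ := hR.exists_map hFac huw
    have hu : ∀ {v}, q v = q u → v ∈ {v | F.Reachable u v} := fun h => hqq.1 h.symm
    exact ⟨φ, ⟨fun v hv v' hv' h => h2 (hu hv) (hu hv') h, fun v hv => h3 v (hu hv),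
      fun v hv => hw.trans (h4 v (hu hv)), fun v v' hv hv' => h5 v (hu hv) v' (hu hv')⟩, h1⟩
  -- The identifications `σ d` of the components with that of `r` are chosen so that all ports
  -- leading to the same `c` have the same image. By `hcut` these ports are related, so `exists_map`
  -- can realize any prescribed image.
  obtain ⟨σ, hσ, hσ'⟩ := hT₁.exists_choice Φ (by
      intro d
      induction d using ConnectedComponent.ind with | _ u
      obtain ⟨w, hw, huw⟩ := hall u r
      obtain ⟨φ, hφ, -⟩ := hlift u w hw huw
      exact ⟨φ, hφ⟩) (fun d c φ => φ (port d c)) (by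
      intro c d d' hd hd' φ hφ
      obtain ⟨p1, y, p2, p3, p4⟩ := hport d c hd
      obtain ⟨p1', y', p2', p3', p4'⟩ := hport d' c hd'
      have hRR := hcut _ _ _ _ p3' p4' p3 p4 (hqq.1 (p2'.trans p2.symm))
      obtain ⟨φ', h1, h2⟩ := hlift (port d' c) (φ (port d c)) (hφ.2.2.1 _ p1)
        (hR.equiv.trans hRR (hφ.2.1 _ p1))
      rw [p1'] at h1
      exact ⟨φ', h1, h2⟩)
  -- The common image of the ports leading to `c` is the value `f c`; without neighbours any value
  -- will do.
  have hf : ∀ c, ∃ w : (q r).supp, ∀ d, T₁.Adj d c → σ d (port d c) = w.1 := by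
    intro c
    by_cases h : ∃ d, T₁.Adj d c
    · obtain ⟨d, hd⟩ := h
      exact ⟨⟨σ d (port d c), (hqq.2 ((hσ d).2.2.1 _ (hport d c hd).1)).symm⟩,
        fun d' hd' => hσ' c d' d hd' hd⟩
    · exact ⟨⟨r, rfl⟩, fun d hd => (h ⟨d, hd⟩).elim⟩
  choose f hf using hf
  let h : V → V := fun v => σ (q v) v
  have hh : ∀ v, F.Reachable r (h v) := fun v => (hσ (q v)).2.2.1 v rfl
  have hinj : ∀ {x y}, q x = q y → h x = h y → x = y := by
    intro x y hxy he
    refine (hσ (q y)).1 hxy rfl ?_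
    simp only [h] at he
    rwa [hxy] at he
  have hhom : ∀ {v w}, F.Adj v w → F.Adj (h v) (h w) := by
    intro v w hvw
    have e1 : q w = q v := hqq.2 hvw.symm.reachable
    simp only [h]
    rw [e1]
    exact (hσ (q v)).2.2.2 v w rfl e1 hvw
  have hsupp : ∀ c : F.ConnectedComponent, {v | q v = c}.ncard = b := by
    intro c
    induction c using ConnectedComponent.ind with | _ u
    rw [← hsize u]
    congr 1
    ext v
    exact hqq.trans reachable_comm
  -- An injection between components of equal size `b` is onto.
  have hsurj : ∀ c, ∀ w, F.Reachable r w → ∃ v, q v = c ∧ h v = w := by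
    intro c w hw
    have himg : h '' {v | q v = c} = {w | F.Reachable r w} := by
      refine Set.eq_of_subset_of_ncard_le ?_ ?_
      · rintro _ ⟨v, -, rfl⟩
        exact hh v
      · have hio : {v | q v = c}.InjOn h := fun x hx y hy he => hinj (Eq.trans hx (Eq.symm hy)) he
        rw [hio.ncard_image, hsupp, hsize]
    obtain ⟨v, hv, hv'⟩ := (Set.ext_iff.1 himg w).2 hw
    exact ⟨v, hv, hv'⟩
  have hcutport : ∀ {x y}, X.Adj x y → ¬ F.Adj x y → port (q x) (q y) = x := by
    intro x y h1 h2
    obtain ⟨p1, y', p2, p3, p4⟩ := hport (q x) (q y) ⟨x, y, rfl, rfl, h1, h2⟩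
    exact huniq p3 p4 h1 h2 (hqq.1 p1) (hqq.1 p2)
  have hcutf : ∀ {x y}, X.Adj x y → ¬ F.Adj x y → h x = f (q y) := by
    intro x y h1 h2
    rw [← hf (q y) (q x) ⟨x, y, rfl, rfl, h1, h2⟩, hcutport h1 h2]
  have hne1 : Nontrivial F.ConnectedComponent := by
    by_contra hn
    rw [not_nontrivial_iff_subsingleton] at hn
    have : {v | q v = q r} = Set.univ := Set.eq_univ_of_forall fun v => Subsingleton.elim _ _
    have h2 := hsupp (q r)
    rw [this, Set.ncard_univ] at h2
    omega
  have hne2 : Nontrivial (q r).supp := by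
    rw [Set.nontrivial_coe_sort, ← Set.one_lt_ncard_iff_nontrivial]
    exact hb1.trans_eq (hsupp (q r)).symm
  refine ⟨F.ConnectedComponent, (q r).supp, T₁, F.induce (q r).supp, f, hne1, hne2, hT₁,
    ⟨(q r).connected_toSimpleGraph, hFac.induce _⟩, ⟨⟨Equiv.ofBijective
      (fun v => (q v, ⟨h v, (hqq.2 (hh v)).symm⟩)) ⟨?_, ?_⟩, ?_⟩⟩⟩
  · intro x y he
    simp only [Prod.mk.injEq] at he
    exact hinj he.1 (congrArg Subtype.val he.2)
  · rintro ⟨c, w, hw⟩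
    obtain ⟨v, rfl, rfl⟩ := hsurj c w (hqq.1 (Eq.symm hw))
    exact ⟨v, rfl⟩
  · intro x y
    simp only [sierpinskiProduct, comap_adj, Function.Embedding.subtype_apply]
    constructor
    · rintro (⟨h1, h2⟩ | ⟨h1, h2, h3⟩)
      · refine hF (hFac.adj_of_adj_map (S := {v | F.Reachable x v}) (φ := h) ?_ ?_
          (Reachable.rfl : F.Reachable x x) (hqq.1 h1) (hqq.1 h1).within h2)
        · intro v hv w hw he
          exact hinj (hqq.2 ((Reachable.symm hv).trans hw)) he
        · exact fun v _ w _ hvw => hhom hvw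
      · obtain ⟨x', y', e1, e2, e3, e4⟩ := h1
        change q x' = q x at e1
        change q y' = q y at e2
        have h2' : h x = f (q y) := congrArg Subtype.val h2
        have h3' : h y = f (q x) := congrArg Subtype.val h3
        -- Both lie in the same component and `h` sends both to `f (q y)`.
        have hx : x = x' := by
          refine hinj e1.symm ?_
          rw [hcutf e3 e4, e2, ← h2']
        have hy : y = y' := by
          refine hinj e2.symm ?_
          rw [hcutf e3.symm (fun h => e4 h.symm), e1, ← h3']
        rwa [hx, hy]
    · intro hxy
      by_cases hxy' : F.Adj x y
      · left
        exact ⟨hqq.2 hxy'.reachable, hhom hxy'⟩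
      · exact .inr ⟨⟨x, y, rfl, rfl, hxy, hxy'⟩, Subtype.ext (hcutf hxy hxy'),
          Subtype.ext (hcutf hxy.symm fun h => hxy' h.symm)⟩

end SimpleGraph

/-! ### Edge counts, and recovering the fibres of a product -/

namespace SimpleGraph

open Classical in
/-- The number of darts of a finite graph. -/
noncomputable def dartCount {V : Type*} [Fintype V] (G : SimpleGraph V) : ℕ :=
  ∑ u, ∑ v, if G.Adj u v then 1 else 0

theorem Iso.dartCount_eq {V W : Type*} [Fintype V] [Fintype W] {G : SimpleGraph V}
    {H : SimpleGraph W} (e : G ≃g H) : G.dartCount = H.dartCount := by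
  classical
  unfold dartCount
  refine Fintype.sum_equiv e.toEquiv _ _ fun u => Fintype.sum_equiv e.toEquiv _ _ fun v => ?_
  exact by simp only [RelIso.coe_fn_toEquiv, e.map_adj_iff]

/-- By the handshake lemma darts are twice the edges, and a connected graph is a tree exactly when
it has one edge less than vertices. Darts are what the adjacency matrix counts directly. -/
theorem Connected.isTree_iff_dartCount {V : Type*} [Fintype V] {G : SimpleGraph V}
    (hG : G.Connected) : G.IsTree ↔ G.dartCount + 2 = 2 * Fintype.card V := by
  classical
  have h1 : G.dartCount = 2 * G.edgeFinset.card := by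
    unfold dartCount
    rw [← sum_degrees_eq_twice_card_edges]
    refine Finset.sum_congr rfl fun u _ => ?_
    rw [← Finset.card_filter, ← card_neighborFinset_eq_degree, neighborFinset_eq_filter]
  rw [isTree_iff_connected_and_card, h1, Nat.card_eq_fintype_card, Nat.card_eq_fintype_card,
    ← edgeFinset_card]
  simp only [hG, true_and]
  omega

theorem IsTree.dartCount_add_two {V : Type*} [Fintype V] {G : SimpleGraph V} (hG : G.IsTree) :
    G.dartCount + 2 = 2 * Fintype.card V := hG.connected.isTree_iff_dartCount.1 hG

/-- Each vertex of `G` contributes a copy of `H`, and each dart of `G` exactly one connecting dart;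
no dart is of both kinds. -/
theorem dartCount_sierpinskiProduct {V W : Type*} [Fintype V] [Fintype W] (G : SimpleGraph V)
    (H : SimpleGraph W) (f : V → W) :
    (sierpinskiProduct G H f).dartCount = Fintype.card V * H.dartCount + G.dartCount := by
  classical
  have key : ∀ g h g' h', (if (sierpinskiProduct G H f).Adj (g, h) (g', h') then 1 else 0) =
      (if g = g' then if H.Adj h h' then 1 else 0 else 0) +
      (if h' = f g then if h = f g' then if G.Adj g g' then 1 else 0 else 0 else 0) := by
    intro g h g' h'
    by_cases hg : g = g'
    · subst hg
      simp [sierpinskiProduct]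
    · by_cases h1 : G.Adj g g' <;> by_cases h2 : h' = f g <;> by_cases h3 : h = f g' <;>
        simp [sierpinskiProduct, hg, h1, h2, h3]
  simp only [dartCount, Fintype.sum_prod_type, key, Finset.sum_add_distrib]
  congr 1
  · simp [Finset.mul_sum]
  · refine Finset.sum_congr rfl fun g _ => ?_
    simp only [Finset.sum_ite_eq', Finset.mem_univ, if_true]
    rw [Finset.sum_comm]
    simp

theorem finite_of_iso_sierpinskiProduct {V V₁ V₂ : Type*} [Finite V] {X : SimpleGraph V}
    {T₁ : SimpleGraph V₁} {T₂ : SimpleGraph V₂} {f : V₁ → V₂} [Nonempty V₁] [Nonempty V₂]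
    (e : X ≃g sierpinskiProduct T₁ T₂ f) : Finite V₁ ∧ Finite V₂ := by
  have : Finite (V₁ × V₂) := Finite.of_equiv _ e.toEquiv
  exact ⟨Finite.prod_left V₂, Finite.prod_right V₁⟩

theorem Connected.isTree_of_iso_sierpinskiProduct {V V₁ V₂ : Type*} [Finite V]
    {X : SimpleGraph V} (hX : X.Connected) {T₁ : SimpleGraph V₁} {T₂ : SimpleGraph V₂}
    {f : V₁ → V₂} (h₁ : T₁.IsTree) (h₂ : T₂.IsTree) (e : X ≃g sierpinskiProduct T₁ T₂ f) :
    X.IsTree := by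
  have := h₁.connected.nonempty
  have := h₂.connected.nonempty
  obtain ⟨_, _⟩ := finite_of_iso_sierpinskiProduct e
  have := Fintype.ofFinite V
  have := Fintype.ofFinite V₁
  have := Fintype.ofFinite V₂
  rw [hX.isTree_iff_dartCount, e.dartCount_eq, dartCount_sierpinskiProduct,
    Fintype.card_congr e.toEquiv, Fintype.card_prod]
  have e1 := h₁.dartCount_add_two
  have e2 := congrArg (Fintype.card V₁ * ·) h₂.dartCount_add_two
  simp only [mul_add] at e2
  linarith

theorem Connected.exists_iso_sierpinskiProduct_iff {V : Type} [Fintype V] {X : SimpleGraph V}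
    (hX : X.Connected) :
    (∃ (V₁ V₂ : Type) (T₁ : SimpleGraph V₁) (T₂ : SimpleGraph V₂) (f : V₁ → V₂),
      T₁.IsTree ∧ T₂.IsTree ∧ Nonempty (X ≃g sierpinskiProduct T₁ T₂ f)) ↔
      X.dartCount + 2 = 2 * Fintype.card V := by
  rw [← hX.isTree_iff_dartCount]
  constructor
  · rintro ⟨V₁, V₂, T₁, T₂, f, h₁, h₂, ⟨e⟩⟩
    exact hX.isTree_of_iso_sierpinskiProduct h₁ h₂ e
  · intro h
    obtain ⟨r⟩ := hX.nonempty
    -- A one-vertex first factor, so the value of `f` does not matter.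
    refine ⟨Unit, V, ⊥, X, fun _ => r, .of_subsingleton, h,
      ⟨⟨(Equiv.punitProd V).symm, ?_⟩⟩⟩
    intro a b
    simp [sierpinskiProduct]

/-! ### The forest cut out of a tree by a divisor -/

variable {V : Type*}

/-- The vertices on the side of `x` of the edge `xy`. -/
def side (X : SimpleGraph V) (x y : V) : Set V := {w | (X.deleteEdges {s(x, y)}).Reachable x w}

/-- The graph with the edges of `X` that leave on neither side a number of vertices divisible by
`b`. -/
def cutForest (X : SimpleGraph V) (b : ℕ) : SimpleGraph V where
  Adj x y := X.Adj x y ∧ ¬ b ∣ (X.side x y).ncard ∧ ¬ b ∣ (X.side y x).ncard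
  symm := ⟨fun _ _ h => ⟨h.1.symm, h.2.2, h.2.1⟩⟩
  loopless := ⟨fun _ h => X.loopless.irrefl _ h.1⟩

/-- The components of the forest cut out by `b` are isomorphic trees with `b` vertices, in such a
way that the remaining edges that lead to the same component start at corresponding vertices. -/
def IsUniformlyCut (X : SimpleGraph V) (b : ℕ) : Prop :=
  (∀ u, {w | (X.cutForest b).Reachable u w}.ncard = b) ∧
  (∀ u w, ∃ w', (X.cutForest b).Reachable w w' ∧
    (X.cutForest b).Similar (Nat.card V * Nat.card V) u w') ∧
  ∀ x y x' y', X.Adj x y → ¬ (X.cutForest b).Adj x y → X.Adj x' y' →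
    ¬ (X.cutForest b).Adj x' y' → (X.cutForest b).Reachable y y' →
      (X.cutForest b).Similar (Nat.card V * Nat.card V) x x'

open Classical in
/-- The number of elements of a set modulo the size of the fibres of a map, for a set that is a
union of fibres except for one fibre. -/
theorem ncard_eq_fibre_add_mul {V W : Type*} [Finite V] [Finite W] (g : V → W) {b : ℕ}
    (hg : ∀ c, {v | g v = c}.ncard = b) (S : Set V) (c₀ : W)
    (hS : ∀ v w, g v = g w → g v ≠ c₀ → v ∈ S → w ∈ S) :
    ∃ k, S.ncard = {v | v ∈ S ∧ g v = c₀}.ncard + b * k := by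
  have := Fintype.ofFinite V
  have := Fintype.ofFinite W
  have h1 : ∀ P : V → Prop, {v | P v}.ncard = (Finset.univ.filter P).card := by
    intro P
    rw [← Set.ncard_coe_finset]
    simp
  have h2 : S.ncard = ∑ c, {v | v ∈ S ∧ g v = c}.ncard := by
    change {v | v ∈ S}.ncard = _
    rw [h1, Finset.card_eq_sum_card_fiberwise (f := g) (t := Finset.univ) (by simp)]
    refine Finset.sum_congr rfl fun c _ => ?_
    rw [Finset.filter_filter]
    rw [h1 fun v => v ∈ S ∧ g v = c]
    congr
  have h3 : ∀ c ∈ Finset.univ.erase c₀, b ∣ {v | v ∈ S ∧ g v = c}.ncard := by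
    intro c hc
    by_cases h : ∃ v ∈ S, g v = c
    · obtain ⟨v, hv, rfl⟩ := h
      have : {w | w ∈ S ∧ g w = g v} = {w | g w = g v} := by
        ext w
        exact ⟨fun h => h.2, fun h => ⟨hS v w (Eq.symm h) (Finset.ne_of_mem_erase hc) hv, h⟩⟩
      rw [this, hg]
    · have : {w | w ∈ S ∧ g w = c} = ∅ := by
        ext w
        exact ⟨fun h' => h ⟨w, h'⟩, fun h' => h'.elim⟩
      simp [this]
  obtain ⟨k, hk⟩ := Finset.dvd_sum h3
  exact ⟨k, by rw [h2, ← Finset.add_sum_erase _ _ (Finset.mem_univ c₀), hk]⟩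

/-- Divisibility of the sides shows that the cut forest consists of the edges inside the fibres.
Vertices with equal second coordinate are then similar, and an edge into the fibre of `c` starts at
second coordinate `f c`. -/
theorem IsTree.isUniformlyCut_of_iso {V V₁ V₂ : Type*} [Finite V] [Finite V₁] [Finite V₂]
    {X : SimpleGraph V} (hX : X.IsTree) {T₁ : SimpleGraph V₁}
    {T₂ : SimpleGraph V₂} {f : V₁ → V₂} (h₂ : T₂.IsTree)
    (e : X ≃g sierpinskiProduct T₁ T₂ f) : X.IsUniformlyCut (Nat.card V₂) := by
  set b := Nat.card V₂ with hb
  have hadj : ∀ x y, X.Adj x y ↔ ((e x).1 = (e y).1 ∧ T₂.Adj (e x).2 (e y).2) ∨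
      (T₁.Adj (e x).1 (e y).1 ∧ (e x).2 = f (e y).1 ∧ (e y).2 = f (e x).1) := fun x y =>
    e.map_adj_iff.symm
  have hfib : ∀ c, {v | (e v).1 = c}.ncard = b := by
    intro c
    refine Nat.card_congr ⟨fun v => (e v.1).2, fun k => ⟨e.symm (c, k), by simp⟩, ?_, ?_⟩
    · rintro ⟨v, rfl⟩
      simp
    · intro k
      simp
  have hreach : ∀ (F : SimpleGraph V) c,
      (∀ v w, X.Adj v w → (e v).1 = c → (e w).1 = c → F.Adj v w) →
      ∀ v w, (e v).1 = c → (e w).1 = c → F.Reachable v w := by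
    rintro F c hF v w rfl hvw
    have h := (h₂.connected.preconnected (e v).2 (e w).2).transport (H := F)
      (f := fun k => e.symm ((e v).1, k)) fun k l hkl => Adj.reachable
        (hF _ _ ((hadj _ _).2 (.inl (by simpa using hkl))) (by simp) (by simp))
    simp only [Prod.mk.eta, RelIso.symm_apply_apply] at h
    rwa [← hvw, Prod.mk.eta, RelIso.symm_apply_apply] at h
  -- Fibres not containing the edge `xy` stay connected without it, hence lie wholly on one side.
  -- The fibre of `x` is split exactly when it also contains `y`, and then its part is strictly
  -- between `0` and `b`.
  have hdvd : ∀ x y, X.Adj x y → (b ∣ (X.side x y).ncard ↔ (e x).1 ≠ (e y).1) := by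
    intro x y hxy
    have hx : x ∈ X.side x y := Reachable.rfl
    have hy : y ∉ X.side x y := hX.isAcyclic.not_reachable_deleteEdges hxy
    have hedge : ∀ v w, X.Adj v w → ¬ ((v = x ∧ w = y) ∨ (v = y ∧ w = x)) →
        (X.deleteEdges {s(x, y)}).Adj v w := fun v w h h' => deleteEdges_pair_adj.2 ⟨h, h'⟩
    by_cases hg : (e x).1 = (e y).1
    · simp only [hg, ne_eq, not_true, iff_false]
      obtain ⟨k, hk⟩ := ncard_eq_fibre_add_mul (fun v => (e v).1) hfib (X.side x y) (e x).1 (by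
        intro v w hvw hne hv
        refine Reachable.trans hv (hreach _ (e v).1 (fun a c hac ha hc => hedge a c hac ?_) v w
          rfl hvw.symm)
        rintro (⟨rfl, rfl⟩ | ⟨rfl, rfl⟩)
        · exact hne ha.symm
        · exact hne hc.symm)
      rw [hk, Nat.dvd_add_left (Dvd.intro _ rfl)]
      have hpos : 0 < {v | v ∈ X.side x y ∧ (e v).1 = (e x).1}.ncard :=
        (Set.ncard_pos (Set.toFinite _)).2 ⟨x, hx, rfl⟩
      have hlt : {v | v ∈ X.side x y ∧ (e v).1 = (e x).1}.ncard < b := by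
        rw [← hfib (e x).1]
        exact Set.ncard_lt_ncard ⟨fun v hv => hv.2,
          fun h => hy (h (show y ∈ {v | (e v).1 = (e x).1} from hg.symm)).1⟩
      exact Nat.not_dvd_of_pos_of_lt hpos hlt
    · simp only [ne_eq, hg, not_false_iff, iff_true]
      have hclosed : ∀ v w, (e v).1 = (e w).1 → v ∈ X.side x y → w ∈ X.side x y := by
        intro v w hvw hv
        refine Reachable.trans hv (hreach _ (e v).1 (fun a c hac ha hc => hedge a c hac ?_) v w
          rfl hvw.symm)
        rintro (⟨rfl, rfl⟩ | ⟨rfl, rfl⟩)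
        · exact hg (ha.trans hc.symm)
        · exact hg (hc.trans ha.symm)
      obtain ⟨k, hk⟩ := ncard_eq_fibre_add_mul (fun v => (e v).1) hfib (X.side x y) (e x).1
        fun v w hvw _ hv => hclosed v w hvw hv
      have : {v | v ∈ X.side x y ∧ (e v).1 = (e x).1} = {v | (e v).1 = (e x).1} := by
        ext v
        exact ⟨fun h => h.2, fun h => ⟨hclosed x v (Eq.symm h) hx, h⟩⟩
      rw [hk, this, hfib]
      exact dvd_add dvd_rfl (Dvd.intro _ rfl)
  have hF : ∀ x y, (X.cutForest b).Adj x y ↔ X.Adj x y ∧ (e x).1 = (e y).1 := by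
    intro x y
    simp only [cutForest]
    refine and_congr_right fun hxy => ?_
    rw [hdvd x y hxy, hdvd y x hxy.symm]
    tauto
  have hFr : ∀ u w, (X.cutForest b).Reachable u w ↔ (e u).1 = (e w).1 := by
    intro u w
    refine ⟨fun h => h.mem_of_closed (S := {w | (e u).1 = (e w).1})
      (fun a c hac ha => Eq.trans ha ((hF a c).1 hac).2) rfl, fun h => ?_⟩
    exact hreach _ (e u).1 (fun a c hac ha hc => (hF a c).2 ⟨hac, ha.trans hc.symm⟩) u w rfl h.symm
  have hFadj : ∀ x y, (X.cutForest b).Adj x y ↔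
      (e x).1 = (e y).1 ∧ T₂.Adj (e x).2 (e y).2 := by
    intro x y
    rw [hF, hadj]
    constructor
    · rintro ⟨h | h, h'⟩
      · exact h
      · exact (T₁.loopless.irrefl _ (h' ▸ h.1)).elim
    · exact fun h => ⟨.inl h, h.1⟩
  have hsim : ∀ u v, (e u).2 = (e v).2 →
      (X.cutForest b).Similar (Nat.card V * Nat.card V) u v := by
    intro u v huv
    -- Equality of second coordinates is a bisimulation: neighbours correspond by exchanging the
    -- fibre.
    refine similar_of_bisimulation _ (fun u v => (e u).2 = (e v).2) ?_ _ huv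
    intro u v huv
    refine ⟨⟨fun z => ⟨e.symm ((e v).1, (e z.1).2), ?_⟩, fun z => ⟨e.symm ((e u).1, (e z.1).2), ?_⟩,
      ?_, ?_⟩, ?_⟩
    · have := (hFadj _ _).1 z.2
      rw [hFadj]
      simpa [← huv] using this.2
    · have := (hFadj _ _).1 z.2
      rw [hFadj]
      simpa [huv] using this.2
    · rintro ⟨z, hz⟩
      have := (hFadj _ _).1 hz
      simp [this.1]
    · rintro ⟨z, hz⟩
      have := (hFadj _ _).1 hz
      simp [this.1]
    · intro z
      simp
  refine ⟨fun u => ?_, fun u w => ⟨e.symm ((e w).1, (e u).2), ?_, hsim _ _ ?_⟩,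
    fun x y x' y' h1 h2 h1' h2' h => hsim _ _ ?_⟩
  · refine Eq.trans (congrArg Set.ncard (Set.ext fun w => ?_)) (hfib (e u).1)
    exact (hFr u w).trans eq_comm
  · rw [hFr]
    simp
  · simp
  · have key : ∀ x y, X.Adj x y → ¬ (X.cutForest b).Adj x y → (e x).2 = f (e y).1 := by
      intro x y h1 h2
      rw [hFadj] at h2
      exact (((hadj x y).1 h1).resolve_left h2).2.1
    rw [key x y h1 h2, key x' y' h1' h2', (hFr y y').1 h]

theorem Connected.exists_nontrivial_iso_sierpinskiProduct_iff {V : Type} [Fintype V]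
    {X : SimpleGraph V} (hX : X.Connected) :
    (∃ (V₁ V₂ : Type) (T₁ : SimpleGraph V₁) (T₂ : SimpleGraph V₂) (f : V₁ → V₂),
      Nontrivial V₁ ∧ Nontrivial V₂ ∧ T₁.IsTree ∧ T₂.IsTree ∧
        Nonempty (X ≃g sierpinskiProduct T₁ T₂ f)) ↔
      X.dartCount + 2 = 2 * Fintype.card V ∧
        ∃ b < Fintype.card V, 1 < b ∧ X.IsUniformlyCut b := by
  rw [← hX.isTree_iff_dartCount]
  constructor
  · rintro ⟨V₁, V₂, T₁, T₂, f, _, _, h₁, h₂, ⟨e⟩⟩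
    obtain ⟨_, _⟩ := finite_of_iso_sierpinskiProduct e
    have hT := hX.isTree_of_iso_sierpinskiProduct h₁ h₂ e
    refine ⟨hT, Nat.card V₂, ?_, Finite.one_lt_card, hT.isUniformlyCut_of_iso h₂ e⟩
    rw [← Nat.card_eq_fintype_card, Nat.card_congr e.toEquiv, Nat.card_prod]
    have : 1 < Nat.card V₁ := Finite.one_lt_card
    have : 1 < Nat.card V₂ := Finite.one_lt_card
    nlinarith
  · rintro ⟨hT, b, hb, hb1, h1, h2, h3⟩
    exact hT.exists_sierpinskiProduct (F := X.cutForest b) (fun _ _ h => h.1) hb1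
      (by rwa [Nat.card_eq_fintype_card]) h1 (similar_isEquitable _) h2 h3

end SimpleGraph

/-! ### The criterion as terms and tables -/

namespace RAM

namespace Term

@[simp] theorem ev_sum {A : ℕ → ℕ → ℕ} {ρ : ℕ → ℕ} {x m : Term} {i : ℕ} : (sum i m x).ev A ρ =
    ∑ k ∈ Finset.range (m.ev A ρ), x.ev A (Function.update ρ i k) := rfl

/-- The number of a pair of vertices. -/
def pair (x y : Term) : Term := .add (.mul x (.var 0)) y

def adj (x y : Term) : Term := .load 0 (pair x y)

/-- Twice the number of edges is twice the number of vertices, less two. -/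
def isTree : Term :=
  eq (.add (.sum 6 (.var 0) (count 7 (.var 0) (adj (.var 6) (.var 7)))) (.const 2))
    (.mul (.const 2) (.var 0))

/-- Table `a` holds reachability in the graph whose adjacency of variables `6` and `5` is given
by `e`. -/
def reachTable (a : ℕ) (e : Term) : Term :=
  table (eq (.var 4) (.var 5))
    (or (prev a (.var 4) (.var 5)) (ex 6 (.var 0) (and (prev a (.var 4) (.var 6)) e)))

/-- Adjacency after the deletion of the edge with the number given by variable `2`. -/
def adjDelete : Term :=
  and (adj (.var 6) (.var 5))
    (not (or (eq (.var 2) (pair (.var 6) (.var 5))) (eq (.var 2) (pair (.var 5) (.var 6)))))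

/-- The number of vertices on the side of `x` of the edge `xy`. -/
def sideCard (x y : Term) : Term := count 8 (.var 0) (final 1 (pair x y) x (.var 8))

/-- Adjacency in the forest cut out by variable `2`. -/
def forestAdj (x y : Term) : Term :=
  and (adj x y) (and (not (dvd 9 (.var 2) (sideCard x y))) (not (dvd 9 (.var 2) (sideCard y x))))

/-- Table `3` holds colour refinement on the forest cut out by the parameter. -/
def similarTable : Term :=
  table (.const 1) (and (prev 3 (.var 4) (.var 5)) (all 6 (.var 0)
    (eq (count 7 (.var 0) (and (forestAdj (.var 4) (.var 7)) (prev 3 (.var 7) (.var 6))))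
      (count 7 (.var 0) (and (forestAdj (.var 5) (.var 7)) (prev 3 (.var 7) (.var 6)))))))

/-- The forest cut out by variable `2` is as in `SimpleGraph.IsUniformlyCut`. -/
def uniform : Term :=
  and (all 3 (.var 0) (eq (count 4 (.var 0) (final 2 (.var 2) (.var 3) (.var 4))) (.var 2)))
  (and (all 3 (.var 0) (all 4 (.var 0) (ex 5 (.var 0)
      (and (final 2 (.var 2) (.var 4) (.var 5)) (final 3 (.var 2) (.var 3) (.var 5))))))
    (all 3 (.var 0) (all 4 (.var 0) (all 5 (.var 0) (all 6 (.var 0) (not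
      (and (adj (.var 3) (.var 4)) (and (not (forestAdj (.var 3) (.var 4)))
      (and (adj (.var 5) (.var 6)) (and (not (forestAdj (.var 5) (.var 6)))
      (and (final 2 (.var 2) (.var 4) (.var 6))
        (not (final 3 (.var 2) (.var 3) (.var 5))))))))))))))

variable {n : ℕ} {X : SimpleGraph (Fin n)} {A : ℕ → ℕ → ℕ} {ρ : ℕ → ℕ}

theorem tr_adj (hA : A 0 = (graphInput X).arr 0) (h0 : ρ 0 = n) {x y : Term} {u v : Fin n}
    (hx : x.ev A ρ = u) (hy : y.ev A ρ = v) : (adj x y).tr A ρ ↔ X.Adj u v := by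
  simp only [adj, pair, tr_load, ev_add, ev_mul, ev_var, hx, hy, h0, hA]
  exact graphInput_arr_zero X u v

theorem tr_isTree (hA : A 0 = (graphInput X).arr 0) (h0 : ρ 0 = n) :
    isTree.tr A ρ ↔ X.dartCount + 2 = 2 * Fintype.card (Fin n) := by
  classical
  simp only [isTree, tr_eq, ev_add, ev_sum, ev_var, ev_const, ev_mul, h0]
  rw [Finset.sum_range, Fintype.card_fin]
  refine Eq.congr_left (congrArg (· + 2) (Finset.sum_congr rfl fun u _ => ?_))
  rw [ev_count (n := n) (by simp [h0]), ← Finset.card_filter, ← Set.ncard_coe_finset]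
  refine congrArg Set.ncard (Set.ext fun v => ?_)
  simp only [Finset.coe_filter, Finset.mem_univ, true_and]
  exact tr_adj hA (by simp [h0]) (by simp) (by simp)

/-- Table `1` holds reachability after the deletion of an edge. -/
def IsSideTable (X : SimpleGraph (Fin n)) (T : ℕ → ℕ) : Prop := ∀ x y u v : Fin n,
  T (RAM.slot n (x * n + y) (n * n) u v) ≠ 0 ↔ (X.deleteEdges {s(x, y)}).Reachable u v

/-- Variables `8` and `9` are bound inside `sideCard` and `forestAdj`; arguments below `8` avoid
capture. -/
theorem ev_sideCard (hT : IsSideTable X (A 1)) (h0 : ρ 0 = n) {i j : ℕ} (hi : i < 8) (hj : j < 8)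
    {x y : Fin n} (hx : ρ i = x) (hy : ρ j = y) :
    (sideCard (.var i) (.var j)).ev A ρ = (X.side x y).ncard := by
  rw [sideCard, ev_count (n := n) (by simpa using h0)]
  refine congrArg Set.ncard (Set.ext fun w => ?_)
  have e0 : Function.update ρ 8 (w : ℕ) 0 = n := by simp [h0]
  have e1 : Function.update ρ 8 (w : ℕ) i = x := by
    rw [Function.update_of_ne (by omega), hx]
  have e2 : Function.update ρ 8 (w : ℕ) j = y := by
    rw [Function.update_of_ne (by omega), hy]
  change (final 1 _ _ _).tr A (Function.update ρ 8 (w : ℕ)) ↔ _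
  simp only [final, pair, tr_load, ev_slot, ev_var, ev_add, ev_mul, e0, e1, e2,
    Function.update_self]
  exact hT x y x w

theorem tr_forestAdj (hA : A 0 = (graphInput X).arr 0) (hT : IsSideTable X (A 1)) (h0 : ρ 0 = n)
    {i j b : ℕ} (hi : i < 8) (hj : j < 8) {x y : Fin n} (hx : ρ i = x) (hy : ρ j = y)
    (hb : ρ 2 = b) : (forestAdj (.var i) (.var j)).tr A ρ ↔ (X.cutForest b).Adj x y := by
  have hside : ∀ {i j : ℕ} {x y : Fin n}, i < 8 → j < 8 → ρ i = x → ρ j = y →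
      ((dvd 9 (.var 2) (sideCard (.var i) (.var j))).tr A ρ ↔ b ∣ (X.side x y).ncard) := by
    intro i j x y hi hj hx hy
    rw [tr_dvd, ev_sideCard hT h0 hi hj hx hy, ev_var, hb]
    · simp
    · intro k
      rw [ev_sideCard hT h0 hi hj hx hy, ev_sideCard hT (by simp [h0]) hi hj
        (by rw [Function.update_of_ne (by omega), hx])
        (by rw [Function.update_of_ne (by omega), hy])]
  rw [forestAdj, tr_and, tr_and, tr_not, tr_not, hside hi hj hx hy, hside hj hi hy hx,
    tr_adj hA h0 (x := .var i) (y := .var j) hx hy]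
  rfl

end Term

/-- Stated for a family of graphs indexed by the parameter, as it serves both for deleted edges and
for cut forests. -/
theorem fillTable_reachTable {n : ℕ} (a : ℕ) (e : Term) (A : ℕ → ℕ → ℕ)
    (G : ℕ → SimpleGraph (Fin n))
    (he : ∀ B : ℕ → ℕ → ℕ, (∀ c ≠ a, B c = A c) → ∀ ρ : ℕ → ℕ, ∀ u v : Fin n, ρ 0 = n →
      ρ 6 = u → ρ 5 = v → (e.tr B ρ ↔ (G (ρ 2)).Adj u v))
    (B : ℕ → ℕ → ℕ) (hB : B = fillTable a (.reachTable a e) (inputEnv n) A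
      (Term.tableSize.ev A (inputEnv n))) :
    (∀ c ≠ a, B c = A c) ∧ ∀ p < n * n, ∀ u v : Fin n,
      B a (slot n p (n * n) u v) ≠ 0 ↔ (G p).Reachable u v := by
  obtain ⟨h1, h2⟩ := fillTable_table a _ _ A n (fun p t u v => (G p).ReachableWithin t u v) (by
      intro B _ i p _ u v
      simp [tableEnv, SimpleGraph.ReachableWithin, Fin.ext_iff]) (by
      intro B hB i p _ t ht u v
      simp only [Term.tr_or, Term.prev, Term.tr_load, Term.ev_slot, Term.tr_ex, Term.tr_and,
        SimpleGraph.ReachableWithin, ← ht]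
      refine or_congr (by simp [tableEnv, inputEnv, Term.ev]) ?_
      rw [show (Term.var 0).ev B (tableEnv n i p (t + 1) u v) = n by simp [tableEnv, inputEnv],
        exists_lt_iff_fin]
      refine exists_congr fun w => and_congr (by simp [tableEnv, inputEnv, Term.ev]) ?_
      rw [he B hB _ w v]
      · simp [tableEnv]
      · simp [tableEnv, inputEnv]
      · simp [tableEnv]
      · simp [tableEnv]) B hB
  refine ⟨h1, fun p hp u v => ?_⟩
  rw [h2 p hp _ le_rfl, ← SimpleGraph.reachableWithin_iff, Nat.card_eq_fintype_card,
    Fintype.card_fin]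

/-- The tables needed to decide whether a graph is a Sierpiński product of nontrivial trees. -/
def factorTables : List (ℕ × Term × Term) :=
  [(1, .tableSize, .reachTable 1 .adjDelete),
    (2, .tableSize, .reachTable 2 (.forestAdj (.var 6) (.var 5))),
    (3, .tableSize, .similarTable)]

theorem fillTables_factorTables {n : ℕ} (X : SimpleGraph (Fin n)) (A : ℕ → ℕ → ℕ)
    (hA : A = fillTables (inputEnv n) (graphInput X).arr factorTables) :
    A 0 = (graphInput X).arr 0 ∧ Term.IsSideTable X (A 1) ∧
    (∀ p < n * n, ∀ u v : Fin n,
      A 2 (slot n p (n * n) u v) ≠ 0 ↔ (X.cutForest p).Reachable u v) ∧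
    ∀ p < n * n, ∀ u v : Fin n,
      A 3 (slot n p (n * n) u v) ≠ 0 ↔ (X.cutForest p).Similar (n * n) u v := by
  classical
  simp only [factorTables, fillTables] at hA
  set A₁ := fillTable 1 (.reachTable 1 .adjDelete) (inputEnv n) (graphInput X).arr
    (Term.tableSize.ev (graphInput X).arr (inputEnv n)) with hA₁
  set A₂ := fillTable 2 (.reachTable 2 (.forestAdj (.var 6) (.var 5))) (inputEnv n) A₁
    (Term.tableSize.ev A₁ (inputEnv n)) with hA₂
  -- The deleted set is written so as to make sense for every `p`; when `p` is the number of a pair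
  -- it is a single edge.
  obtain ⟨h1, h1'⟩ := fillTable_reachTable 1 _ _ (fun p => X.deleteEdges
    {e | ∃ u v : Fin n, p = u * n + v ∧ e = s(u, v)}) (by
      intro B hB ρ u v h0 h6 h5
      simp only [Term.adjDelete, Term.tr_and, Term.tr_not, Term.tr_or, Term.tr_eq, Term.pair,
        Term.ev_var, Term.ev_add, Term.ev_mul, h0, h6, h5, SimpleGraph.deleteEdges_adj]
      rw [Term.tr_adj (hB 0 (by simp)) h0 (u := u) (v := v) (by simpa) (by simpa)]
      refine and_congr_right fun _ => not_congr ?_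
      constructor
      · rintro (h | h)
        · exact ⟨u, v, h, rfl⟩
        · exact ⟨v, u, h, Sym2.eq_swap⟩
      · rintro ⟨x, y, h, hxy⟩
        rcases Sym2.eq_iff.1 hxy with ⟨rfl, rfl⟩ | ⟨rfl, rfl⟩
        · exact .inl h
        · exact .inr h) A₁ hA₁
  have hside : Term.IsSideTable X (A₁ 1) := by
    intro x y u v
    rw [h1' _ (mul_add_lt x.2 y.2)]
    suffices {e | ∃ u v : Fin n, (x * n + y : ℕ) = u * n + v ∧ e = s(u, v)} = {s(x, y)} by
      rw [this]
    ext e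
    constructor
    · rintro ⟨a, b, h, rfl⟩
      obtain ⟨h1, h2⟩ := mul_add_inj y.2 b.2 h
      rw [Fin.ext h1, Fin.ext h2]
      rfl
    · rintro rfl
      exact ⟨x, y, rfl, rfl⟩
  obtain ⟨h2, h2'⟩ := fillTable_reachTable 2 _ _ (fun p => X.cutForest p) (by
    intro B hB ρ u v h0 h6 h5
    refine Term.tr_forestAdj ?_ ?_ h0 (by simp) (by simp) h6 h5 rfl
    · rw [hB 0 (by simp), h1 0 (by simp)]
    · rwa [hB 1 (by simp)]) A₂ hA₂
  obtain ⟨h3, h3'⟩ := fillTable_table 3 _ _ A₂ n (fun p t u v => (X.cutForest p).Similar t u v)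
    (by
      intro B _ i p _ u v
      simp [SimpleGraph.Similar]) (by
      intro B hB i p _ t ht u v
      have hB0 : B 0 = (graphInput X).arr 0 := by
        rw [hB 0 (by simp), h2 0 (by simp), h1 0 (by simp)]
      have hB1 : Term.IsSideTable X (B 1) := by
        rw [hB 1 (by simp), h2 1 (by simp)]
        exact hside
      -- Both counts in a refinement step have this form, with `j = 4` for `u` and `j = 5` for `v`.
      have key : ∀ (w : Fin n) (j : ℕ) (x : Fin n), j < 6 → tableEnv n i p (t + 1) u v j = x →
          (Term.count 7 (.var 0) ((Term.forestAdj (.var j) (.var 7)).and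
            (.prev 3 (.var 7) (.var 6)))).ev B
            (Function.update (tableEnv n i p (t + 1) u v) 6 w) =
          {z | (X.cutForest p).Adj x z ∧ (X.cutForest p).Similar t z w}.ncard := by
        intro w j x hj hx
        rw [Term.ev_count (n := n) (by simp [tableEnv, inputEnv])]
        refine congrArg Set.ncard (Set.ext fun z => ?_)
        refine Term.tr_and.trans (and_congr ?_ ?_)
        · refine Term.tr_forestAdj hB0 hB1 (by simp [tableEnv, inputEnv]) (by omega) (by simp) ?_
            (by simp) (by simp [tableEnv])
          rw [Function.update_of_ne (by omega), Function.update_of_ne (by omega), hx]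
        · rw [← ht]
          simp [Term.prev, Term.ev_slot, tableEnv, inputEnv, Term.ev]
      simp only [Term.tr_and, Term.tr_all, Term.tr_eq]
      refine and_congr ?_ ?_
      · rw [← ht]
        simp [Term.prev, Term.ev_slot, tableEnv, inputEnv, Term.ev]
      rw [show (Term.var 0).ev B (tableEnv n i p (t + 1) u v) = n by simp [tableEnv, inputEnv],
        forall_lt_iff_fin]
      refine forall_congr' fun w => ?_
      rw [key w 4 u (by simp) (by simp [tableEnv]), key w 5 v (by simp) (by simp [tableEnv])]) A hA
  refine ⟨?_, ?_, ?_, fun p hp u v => h3' p hp _ le_rfl u v⟩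
  · rw [h3 0 (by simp), h2 0 (by simp), h1 0 (by simp)]
  · rw [h3 1 (by simp), h2 1 (by simp)]
    exact hside
  · intro p hp u v
    rw [h3 2 (by simp)]
    exact h2' p hp u v

theorem tr_uniform {n : ℕ} (X : SimpleGraph (Fin n)) (A : ℕ → ℕ → ℕ)
    (hA : A = fillTables (inputEnv n) (graphInput X).arr factorTables) {b : ℕ} (hb : b < n) :
    Term.uniform.tr A (Function.update (inputEnv n) 2 b) ↔ X.IsUniformlyCut b := by
  classical
  obtain ⟨h0, h1, h2, h3⟩ := fillTables_factorTables X A hA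
  have hb' : b < n * n := hb.trans_le (Nat.le_mul_self n)
  replace h2 := h2 b hb'
  replace h3 := h3 b hb'
  simp only [Term.uniform, SimpleGraph.IsUniformlyCut, Nat.card_eq_fintype_card,
    Fintype.card_fin, ← h2, ← h3]
  simp only [Term.tr_and, Term.tr_all, Term.tr_ex, Term.tr_eq, Term.tr_not,
    Term.ev_var, Term.final, Term.tr_load, Term.ev_slot, Term.ev_mul, ne_eq, Function.update_self,
    Function.update_of_ne, inputEnv, OfNat.zero_ne_ofNat, not_false_eq_true,
    Nat.reduceEqDiff, if_true, forall_lt_iff_fin, exists_lt_iff_fin]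
  refine and_congr (forall_congr' fun u => ?_) (and_congr Iff.rfl (forall_congr' fun x =>
    forall_congr' fun y => forall_congr' fun x' => forall_congr' fun y' => ?_))
  · rw [Term.ev_count (n := n) (by simp [inputEnv])]
    simp [Term.ev_slot, inputEnv]
  · rw [Term.tr_adj h0 (u := x) (v := y), Term.tr_adj h0 (u := x') (v := y'),
      Term.tr_forestAdj (b := b) h0 h1 (x := x) (y := y),
      Term.tr_forestAdj (b := b) h0 h1 (x := x') (y := y')]
    · tauto
    all_goals simp [inputEnv]

end RAM

/-! ### The two decision problems -/

theorem theorem5p2 :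
    RAM.DecidesInPolyTime (fun _ X => X.Connected)
      (fun _ X => ∃ (V₁ V₂ : Type) (T₁ : SimpleGraph V₁) (T₂ : SimpleGraph V₂) (f : V₁ → V₂),
        T₁.IsTree ∧ T₂.IsTree ∧ Nonempty (X ≃g sierpinskiProduct T₁ T₂ f)) ∧
    RAM.DecidesInPolyTime (fun _ X => X.Connected)
      (fun _ X => ∃ (V₁ V₂ : Type) (T₁ : SimpleGraph V₁) (T₂ : SimpleGraph V₂) (f : V₁ → V₂),
        Nontrivial V₁ ∧ Nontrivial V₂ ∧ T₁.IsTree ∧ T₂.IsTree ∧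
          Nonempty (X ≃g sierpinskiProduct T₁ T₂ f)) := by
  constructor
  · refine RAM.decidesInPolyTime_of_terms [] .isTree fun n X hX => ?_
    rw [hX.exists_iso_sierpinskiProduct_iff]
    exact RAM.Term.tr_isTree rfl rfl
  · refine RAM.decidesInPolyTime_of_terms RAM.factorTables
      (.and .isTree (.ex 2 (.var 0) (.and (.lt (.const 1) (.var 2)) .uniform))) fun n X hX => ?_
    rw [hX.exists_nontrivial_iso_sierpinskiProduct_iff, RAM.Term.tr_and, RAM.Term.tr_isTree
      (RAM.fillTables_factorTables X _ rfl).1 rfl, RAM.Term.tr_ex, Fintype.card_fin]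
    refine and_congr_right fun _ => exists_congr fun b => and_congr_right fun hb => ?_
    rw [RAM.Term.tr_and, RAM.tr_uniform X _ rfl hb]
    simp
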